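/- Let $(M^n,g)$ be a smooth Riemannian manifold of dimension $n\ge 3$ which is a gradient Ricci soliton: there are a smooth function $f:M\to\mathbb R$ and a constant $\lambda\in\mathbb R$ with $$\mathrm{Ric}+\nabla^2 f=\lambda g .$$ Let $R$ be the scalar curvature, $T=\mathrm{Ric}-\frac{R}{n}g$ the traceless Ricci tensor and $\hat E=\left(\mathrm{Ric}-\tfrac12 R\,g\right)e^{-f}$ the weighted Einstein tensor. The sign of the Riemann tensor $R_{ijkl}$ is such that $R_{ijkl}=g_{ik}g_{jl}-g_{il}g_{jk}$ on the unit sphere, and for a symmetric $2$-tensor $S$ put, in an orthonormal frame, $\mathrm{Rm}(S,S)=R_{ijkl}S_{ik}S_{jl}$ (sum over repeated indices). Then on $M$ $$\tfrac12\Delta|\hat E|^2=|\nabla\hat E|^2-\tfrac12\langle\nabla|\hat E|^2,\nabla f\rangle-(n-2)\lambda|\hat E|^2-2\,\mathrm{Rm}(\hat E,\hat E)-\tfrac{n-2}{2}R\left[|\hat E|^2-\tfrac1{n-2}(\mathrm{tr}\,\hat E)^2\right].$$ Moreover, $$\tfrac12\Delta|\hat E|^2=|\nabla\hat E|^2-\tfrac12\langle\nabla|\hat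 E|^2,\nabla f\rangle-(n-2)\lambda|\hat E|^2+Q,$$ where $$Q=e^{-2f}\left[\tfrac{(n-2)^3}{4n^2}R^3-2\,\mathrm{Rm}(T,T)-\tfrac{(n-2)(n-4)}{2n}R|T|^2\right],$$ and if $n=3$, the latter identity also holds with (in an orthonormal frame) $$Q=e^{-2f}\left[4R_{ij}R_{jk}R_{ki}-\tfrac72R|\mathrm{Ric}|^2+\tfrac34R^3\right].$$ -/

import Mathlib

open scoped Manifold ContDiff Bundle

noncomputable section

namespace CoordGeom

/-! ### Tensor calculus in a coordinate domain

All objects below are components with respect to one coordinate system. `G y` is the matrix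
`(g_{ij}(y))` of a Riemannian metric, and a covariant 2-tensor field is a matrix-valued function
`T`, with `T y i j = T_{ij}(y)`. -/

/-- The space `ℝⁿ` in which coordinates take their values. -/
abbrev Coord (n : ℕ) : Type := EuclideanSpace ℝ (Fin n)

/-- Components of a covariant 2-tensor field in coordinates. -/
abbrev Tensor₂ (n : ℕ) : Type := Coord n → Matrix (Fin n) (Fin n) ℝ

variable {n : ℕ}

/-- The partial derivative `∂_i u` at `y`. -/
def pd (i : Fin n) (u : Coord n → ℝ) (y : Coord n) : ℝ :=
  fderiv ℝ u y (EuclideanSpace.single i (1 : ℝ))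

/-- Christoffel symbols of the Levi-Civita connection,
`Γ^k_{ij} = ½ g^{kl} (∂_i g_{jl} + ∂_j g_{il} - ∂_l g_{ij})`. -/
def christoffel (G : Tensor₂ n) (k i j : Fin n) (y : Coord n) : ℝ :=
  (1 / 2) * ∑ l, (G y)⁻¹ k l *
    (pd i (fun z => G z j l) y + pd j (fun z => G z i l) y - pd l (fun z => G z i j) y)

/-- The coefficients of the curvature operator
`R(X, Y) Z = ∇_X ∇_Y Z - ∇_Y ∇_X Z - ∇_{[X, Y]} Z`: the value at `y` of the `l`-th coefficient of
`R(∂_i, ∂_j) ∂_k`. -/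
def curvatureOp (G : Tensor₂ n) (l k i j : Fin n) (y : Coord n) : ℝ :=
  pd i (christoffel G l j k) y - pd j (christoffel G l i k) y
    + ∑ m, (christoffel G l i m y * christoffel G m j k y
      - christoffel G l j m y * christoffel G m i k y)

/-- The Riemann curvature tensor `R_{ijkl} = g(R(∂_i, ∂_j) ∂_l, ∂_k)`. With this sign the unit
sphere has `R_{ijkl} = g_{ik} g_{jl} - g_{il} g_{jk}`. -/
def riemann (G : Tensor₂ n) (i j k l : Fin n) (y : Coord n) : ℝ :=
  ∑ m, G y k m * curvatureOp G m l i j y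

/-- The Ricci tensor `R_{jl} = g^{ik} R_{ijkl}`. -/
def ricci (G : Tensor₂ n) : Tensor₂ n := fun y =>
  Matrix.of fun j l => ∑ i, ∑ k, (G y)⁻¹ i k * riemann G i j k l y

/-- The trace `g^{ij} T_{ij}`. -/
def trace₂ (G T : Tensor₂ n) (y : Coord n) : ℝ :=
  ∑ i, ∑ j, (G y)⁻¹ i j * T y i j

/-- The scalar curvature `R = g^{ij} R_{ij}`. -/
def scalar (G : Tensor₂ n) : Coord n → ℝ := trace₂ G (ricci G)

/-- The Hessian `∇²u = ∂_i ∂_j u - Γ^k_{ij} ∂_k u`. -/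
def hessian (G : Tensor₂ n) (u : Coord n → ℝ) : Tensor₂ n := fun y =>
  Matrix.of fun i j => pd i (pd j u) y - ∑ k, christoffel G k i j y * pd k u y

/-- The Laplace-Beltrami operator, `Δu = g^{ij} (∇²u)_{ij}`. -/
def laplacian (G : Tensor₂ n) (u : Coord n → ℝ) : Coord n → ℝ := trace₂ G (hessian G u)

/-- The inner product `⟨∇u, ∇v⟩ = g^{ij} ∂_i u ∂_j v` of two gradients. -/
def gradInner (G : Tensor₂ n) (u v : Coord n → ℝ) (y : Coord n) : ℝ :=
  ∑ i, ∑ j, (G y)⁻¹ i j * pd i u y * pd j v y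

/-- The covariant derivative of a 2-tensor,
`(∇_k T)_{ij} = ∂_k T_{ij} - Γ^m_{ki} T_{mj} - Γ^m_{kj} T_{im}`. -/
def covDeriv (G T : Tensor₂ n) (k i j : Fin n) (y : Coord n) : ℝ :=
  pd k (fun z => T z i j) y
    - ∑ m, (christoffel G m k i y * T y m j + christoffel G m k j y * T y i m)

/-- The squared norm `|T|² = g^{ik} g^{jl} T_{ij} T_{kl}`. -/
def normSq (G T : Tensor₂ n) (y : Coord n) : ℝ :=
  ∑ i, ∑ j, ∑ k, ∑ l, (G y)⁻¹ i k * (G y)⁻¹ j l * T y i j * T y k l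

/-- The squared norm of the covariant derivative,
`|∇T|² = g^{ab} g^{ik} g^{jl} (∇_a T)_{ij} (∇_b T)_{kl}`. -/
def covDerivNormSq (G T : Tensor₂ n) (y : Coord n) : ℝ :=
  ∑ a, ∑ b, ∑ i, ∑ j, ∑ k, ∑ l, (G y)⁻¹ a b * (G y)⁻¹ i k * (G y)⁻¹ j l *
    covDeriv G T a i j y * covDeriv G T b k l y

/-- Both indices raised: `T^{ij} = g^{ik} g^{jl} T_{kl}`. -/
def raise (G T : Tensor₂ n) (i j : Fin n) (y : Coord n) : ℝ :=
  ∑ k, ∑ l, (G y)⁻¹ i k * (G y)⁻¹ j l * T y k l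

/-- `Rm(T, T) = R_{ijkl} T^{ik} T^{jl}`. -/
def riemannPair (G T : Tensor₂ n) (y : Coord n) : ℝ :=
  ∑ i, ∑ j, ∑ k, ∑ l, riemann G i j k l y * raise G T i k y * raise G T j l y

/-- The trace of the third power of the endomorphism `g⁻¹ T`; in an orthonormal frame this is
`T_{ij} T_{jk} T_{ki}`. -/
def traceCube (G T : Tensor₂ n) (y : Coord n) : ℝ :=
  Matrix.trace (((G y)⁻¹ * T y) ^ 3)

/-- The traceless Ricci tensor `Ric - (R / n) g`. -/
def tracelessRicci (G : Tensor₂ n) : Tensor₂ n := fun y =>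
  ricci G y - (scalar G y / (n : ℝ)) • G y

/-- The weighted Einstein tensor `(Ric - ½ R g) e^{-f}`. -/
def weightedEinstein (G : Tensor₂ n) (f : Coord n → ℝ) : Tensor₂ n := fun y =>
  Real.exp (-f y) • (ricci G y - ((1 / 2) * scalar G y) • G y)

end CoordGeom

open CoordGeom

/-- A smooth Riemannian metric on an `n`-dimensional smooth manifold. -/
abbrev SmoothMetric (n : ℕ) (M : Type*) [TopologicalSpace M] [ChartedSpace (Coord n) M]
    [IsManifold (𝓡 n) ∞ M] : Type _ :=
  Bundle.ContMDiffRiemannianMetric (𝓡 n) ∞ (Coord n) (fun x : M => TangentSpace (𝓡 n) x)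

/-- The `i`-th coordinate vector of the chart `φ`, at the point of `M` with coordinates `y`. -/
def coordVector {n : ℕ} {M : Type*} [TopologicalSpace M] [ChartedSpace (Coord n) M]
    (φ : OpenPartialHomeomorph M (Coord n)) (i : Fin n) (y : Coord n) :
    TangentSpace (𝓡 n) (φ.symm y) :=
  mfderiv (𝓡 n) (𝓡 n) φ.symm y (EuclideanSpace.single i (1 : ℝ) : Coord n)

/-- The components `g_{ij} = g(∂_i, ∂_j)` of a metric in the chart `φ`. -/
def coordMetric {n : ℕ} {M : Type*} [TopologicalSpace M] [ChartedSpace (Coord n) M]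
    [IsManifold (𝓡 n) ∞ M] (g : SmoothMetric n M) (φ : OpenPartialHomeomorph M (Coord n)) :
    Tensor₂ n := fun y =>
  Matrix.of fun i j => g.inner (φ.symm y) (coordVector φ i y) (coordVector φ j y)

/-- `(M, g)` is a gradient Ricci soliton with potential `f` and constant `lam`: the function `f` is
smooth, and `Ric + ∇²f = lam g`, that is, the components of the two sides agree in every smooth
chart. -/
structure IsGradientRicciSoliton {n : ℕ} {M : Type*} [TopologicalSpace M]
    [ChartedSpace (Coord n) M] [IsManifold (𝓡 n) ∞ M] (g : SmoothMetric n M) (f : M → ℝ)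
    (lam : ℝ) : Prop where
  smooth : ContMDiff (𝓡 n) 𝓘(ℝ, ℝ) ∞ f
  equation : ∀ φ ∈ IsManifold.maximalAtlas (𝓡 n) ∞ M, ∀ y ∈ φ.target,
    ricci (coordMetric g φ) y + hessian (coordMetric g φ) (f ∘ φ.symm) y
      = lam • coordMetric g φ y

end

open CoordGeom

/-! By Bochner, ½Δ|E|² = |∇E|² + ⟨E, ΔE⟩, so everything rests on ΔE for E = w(Ric − ½R g), w =
e^{-f}. Differentiating Ric = λg − ∇²f and applying the Ricci identity gives a Codazzi-type
equation, ∇_a R_bc − ∇_b R_ac = f^k R_kcab (`codazzi`), and its trace gives div Ric = Ric(∇f).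
Together with the Bianchi identities they yield ΔRic = ∇_{∇f}Ric + 2λ Ric − 2 R_ikjl R^kl
(`lap_ric`), and by tracing, ΔR.

The product rule for w uses only dw = −w df and Δf = nλ − R. In ΔE the term R(Ric − ½R g) coming
from Δw combines with the shift between Rm(Ric) and Rm(Ric − ½R g), and what is left is a multiple
of g (`lap_einstein`). Pairing it with E gives a multiple of tr E, and |E|² and tr E absorb |Ric|²
and R²; this is the first identity (`lap_normSq_einstein`).

The second identity is algebra: E and T are both of the form W(Ric − u g), so each quantity is a
polynomial in R, |Ric|² and Rm(Ric, Ric). For n = 3 the curvature is determined by Ric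
(`riem_fin_three`), so Rm(Ric, Ric) becomes a combination of tr Ric³, R|Ric|² and R³.

All of this is algebra over a commutative ring with commuting derivations. The ring of smooth
functions on the target of a chart is such a ring, and evaluation at a point turns abstract
identities into coordinate formulas. -/

namespace TensorCalculus

/-! ### Algebraic tensor calculus: contractions and covariant derivatives. -/

/-- A metric with its Levi-Civita connection, in terms of components over a commutative ring with
commuting derivations. -/
structure LeviCivita (A ι : Type*) [CommRing A] [Fintype ι] [DecidableEq ι] where
  d : ι → Derivation ℤ A A
  d_comm : ∀ i j a, d i (d j a) = d j (d i a)
  G : ι → ι → A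
  H : ι → ι → A
  Γ : ι → ι → ι → A
  G_symm : ∀ i j, G i j = G j i
  H_symm : ∀ i j, H i j = H j i
  sum_G_H : ∀ i j, ∑ k, G i k * H k j = if i = j then 1 else 0
  Γ_symm : ∀ k i j, Γ k i j = Γ k j i
  compat : ∀ k i j, d k (G i j) = ∑ m, (Γ m k i * G m j + Γ m k j * G i m)

variable {A ι : Type*} [CommRing A] [Fintype ι] [DecidableEq ι]

/-- A module with a covariant derivative in the coordinate directions. -/
class Connection (L : LeviCivita A ι) (N : Type*) [AddCommGroup N] [Module A N] where
  D : ι → N →+ N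
  leibniz : ∀ a (r : A) (x : N), D a (r • x) = L.d a r • x + r • D a x

namespace LeviCivita

variable (L : LeviCivita A ι)

/-- Base case of a recursion on the rank: functions are differentiated by the derivations
themselves. -/
instance : Connection L A where
  D a := (L.d a : A →+ A)
  leibniz a r x := by simp [add_comm, mul_comm]

/-- The matrix of the metric. -/
def gMat : Matrix ι ι A := Matrix.of L.G

/-- The matrix of the inverse metric. -/
def hMat : Matrix ι ι A := Matrix.of L.H

/-- The matrix of the connection in the direction of the `i`-th coordinate. -/
def connMat (i : ι) : Matrix ι ι A := Matrix.of fun k m => L.Γ k i m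

lemma gMat_mul_hMat : L.gMat * L.hMat = 1 := by
  ext i j
  simp [Matrix.mul_apply, gMat, hMat, L.sum_G_H, Matrix.one_apply]

lemma hMat_mul_gMat : L.hMat * L.gMat = 1 := mul_eq_one_comm.mp L.gMat_mul_hMat

lemma sum_H_G (i j : ι) : ∑ k, L.H i k * L.G k j = if i = j then 1 else 0 := by
  have := congrFun (congrFun L.hMat_mul_gMat i) j
  rwa [Matrix.mul_apply, Matrix.one_apply] at this

lemma map_gMat (c : ι) :
    L.gMat.map (L.d c) = (L.connMat c).transpose * L.gMat + L.gMat * L.connMat c := by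
  ext i j
  simp [Matrix.mul_apply, L.compat, Finset.sum_add_distrib, connMat, gMat, mul_comm]

lemma d_matrix_mul (a : ι) (M M' : Matrix ι ι A) :
    (M * M').map (L.d a) = M.map (L.d a) * M' + M * M'.map (L.d a) := by
  ext i j
  simp [Matrix.mul_apply, Finset.sum_add_distrib, mul_comm, add_comm]

/-- Differentiate G H = 1, solve for the derivative of H, and insert metric compatibility. In
components this says that the inverse metric is parallel. -/
lemma d_H (c a b : ι) :
    L.d c (L.H a b) = -∑ m, (L.Γ a c m * L.H m b + L.Γ b c m * L.H a m) := by
  have h0 : L.gMat.map (L.d c) * L.hMat + L.gMat * L.hMat.map (L.d c) = 0 := by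
    rw [← d_matrix_mul, gMat_mul_hMat]
    ext i j
    rw [Matrix.map_apply, Matrix.one_apply]
    split_ifs <;> simp
  have h2 : L.hMat.map (L.d c) = -(L.hMat * (L.connMat c).transpose + L.connMat c * L.hMat) := by
    calc L.hMat.map (L.d c) = L.hMat * L.gMat * L.hMat.map (L.d c) := by
          rw [hMat_mul_gMat, one_mul]
      _ = L.hMat * (L.gMat.map (L.d c) * L.hMat + L.gMat * L.hMat.map (L.d c))
          - L.hMat * L.gMat.map (L.d c) * L.hMat := by noncomm_ring
      _ = - (L.hMat * (L.connMat c).transpose * (L.gMat * L.hMat)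
          + (L.hMat * L.gMat) * L.connMat c * L.hMat) := by
        rw [h0, map_gMat]; noncomm_ring
      _ = _ := by rw [gMat_mul_hMat, hMat_mul_gMat]; noncomm_ring
  have := congrFun (congrFun h2 a) b
  simp only [Matrix.map_apply, Matrix.neg_apply, Matrix.add_apply, Matrix.mul_apply,
    Matrix.transpose_apply, Matrix.of_apply, connMat, hMat] at this
  rw [this, Finset.sum_add_distrib, add_comm]
  simp [mul_comm]

variable {N N' N'' : Type*} [AddCommGroup N] [Module A N] [AddCommGroup N'] [Module A N']
  [AddCommGroup N''] [Module A N'']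

/-- The contraction `g^{ab} P_{ab}`. -/
def tr (P : ι → ι → N) : N := ∑ a, ∑ b, L.H a b • P a b

lemma tr_add (P Q : ι → ι → N) : L.tr (fun a b => P a b + Q a b) = L.tr P + L.tr Q := by
  simp [tr, Finset.sum_add_distrib]

lemma tr_neg (P : ι → ι → N) : L.tr (fun a b => -P a b) = -L.tr P := by
  simp [tr]

lemma tr_sub (P Q : ι → ι → N) : L.tr (fun a b => P a b - Q a b) = L.tr P - L.tr Q := by
  simp [tr, Finset.sum_sub_distrib, smul_sub]

lemma tr_smul (r : A) (P : ι → ι → N) : L.tr (fun a b => r • P a b) = r • L.tr P := by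
  simp [tr, Finset.smul_sum, smul_comm r]

lemma tr_mul_left (r : A) (P : ι → ι → A) : L.tr (fun a b => r * P a b) = r * L.tr P :=
  L.tr_smul r P

lemma tr_mul_right (r : A) (P : ι → ι → A) : L.tr (fun a b => P a b * r) = L.tr P * r := by
  simp_rw [mul_comm _ r, L.tr_mul_left]

lemma tr_swap (P : ι → ι → N) : L.tr (fun a b => P b a) = L.tr P := by
  rw [tr, tr, Finset.sum_comm]
  simp_rw [L.H_symm]

lemma map_tr (φ : N →ₗ[A] N') (P : ι → ι → N) : φ (L.tr P) = L.tr fun a b => φ (P a b) := by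
  simp [tr]

lemma tr_tr (P : ι → ι → ι → ι → N) :
    L.tr (fun a b => L.tr (fun k l => P a b k l)) = L.tr fun k l => L.tr fun a b => P a b k l := by
  simp only [tr, Finset.smul_sum]
  calc _ = ∑ a, ∑ k, ∑ b, ∑ l, L.H a b • L.H k l • P a b k l :=
        Finset.sum_congr rfl fun a _ => Finset.sum_comm
    _ = ∑ k, ∑ a, ∑ b, ∑ l, L.H a b • L.H k l • P a b k l := Finset.sum_comm
    _ = ∑ k, ∑ a, ∑ l, ∑ b, L.H a b • L.H k l • P a b k l :=
        Finset.sum_congr rfl fun a _ => Finset.sum_congr rfl fun a _ => Finset.sum_comm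
    _ = ∑ k, ∑ l, ∑ a, ∑ b, L.H a b • L.H k l • P a b k l :=
        Finset.sum_congr rfl fun a _ => Finset.sum_comm
    _ = _ := by simp_rw [smul_comm (L.H _ _) (L.H _ _)]

lemma tr_apply (P : ι → ι → ι → N) (c : ι) : L.tr P c = L.tr fun a b => P a b c := by
  simp [tr, Finset.sum_apply]

lemma tr_G_smul (c : ι) (X : ι → N) : L.tr (fun a b => L.G c a • X b) = X c := by
  rw [tr, Finset.sum_comm]
  calc _ = ∑ b, (∑ a, L.G c a * L.H a b) • X b := by
        simp_rw [Finset.sum_smul, smul_smul, mul_comm]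
    _ = X c := by simp [sum_G_H]

lemma tr_G_mul (c : ι) (X : ι → A) : L.tr (fun a b => L.G c a * X b) = X c := L.tr_G_smul c X

/-- The contraction of two families of tensors in their first index, combined by `β`. -/
def pairing (β : N →ₗ[A] N' →ₗ[A] N'') : (ι → N) →ₗ[A] (ι → N') →ₗ[A] N'' :=
  LinearMap.mk₂ A (fun x y => L.tr fun a b => β (x a) (y b))
    (fun x x' y => by simp [tr_add])
    (fun r x y => by simp [tr_smul])
    (fun x y y' => by simp [tr_add])
    (fun r x y => by simp [tr_smul])

lemma pairing_apply (β : N →ₗ[A] N' →ₗ[A] N'') (x : ι → N) (y : ι → N') :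
    L.pairing β x y = L.tr fun a b => β (x a) (y b) := rfl

/-- The contraction `f^k T_k`. -/
def dot : (ι → A) →ₗ[A] (ι → N) →ₗ[A] N := L.pairing (LinearMap.lsmul A N)

lemma dot_eq (f : ι → A) (T : ι → N) : L.dot f T = L.tr fun a b => f a • T b := rfl

/-- The inner product of two covectors. -/
def inner₁ : (ι → A) →ₗ[A] (ι → A) →ₗ[A] A := L.pairing (LinearMap.mul A A)

/-- The inner product of two covariant 2-tensors. -/
def inner₂ : (ι → ι → A) →ₗ[A] (ι → ι → A) →ₗ[A] A := L.pairing L.inner₁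

lemma inner₁_eq (S T : ι → A) : L.inner₁ S T = L.tr fun a b => S a * T b := rfl

lemma inner₂_eq (S T : ι → ι → A) :
    L.inner₂ S T = L.tr fun a b => L.tr fun i j => S a i * T b j := rfl

lemma inner₁_comm (S T : ι → A) : L.inner₁ S T = L.inner₁ T S := by
  rw [inner₁_eq, ← tr_swap, inner₁_eq]; simp_rw [mul_comm]

lemma inner₂_comm (S T : ι → ι → A) : L.inner₂ S T = L.inner₂ T S := by
  change L.tr (fun a b => L.inner₁ (S a) (T b)) = L.tr (fun a b => L.inner₁ (T a) (S b))
  rw [← tr_swap]; simp_rw [L.inner₁_comm]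

lemma inner₂_swap (S T : ι → ι → A) :
    L.inner₂ (fun a b => S b a) (fun a b => T b a) = L.inner₂ S T := by
  rw [inner₂_eq, tr_tr, inner₂_eq]

lemma inner₂_G (S : ι → ι → A) : L.inner₂ L.G S = L.tr S := by
  simp_rw [inner₂_eq, tr_G_mul, tr_swap]

lemma dot_apply (f : ι → A) (T : ι → ι → N) (i : ι) :
    L.dot f T i = L.dot f fun k => T k i := by
  simp [dot_eq, tr_apply]

lemma tr_dot (f : ι → A) (T : ι → ι → ι → N) :
    L.tr (fun i j => L.dot f fun k => T k i j) = L.dot f fun k => L.tr (T k) := by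
  simp_rw [dot_eq, L.tr_tr (fun i j k l => f k • T l i j), tr_smul]

section Connection

variable [Connection L N] [Connection L N'] [Connection L N'']

/-- Recursion step: one more lower index costs one Christoffel term. Iterating from scalars gives
covariant tensors of every rank, so statements for general `N` cover all ranks at once. -/
instance : Connection L (ι → N) where
  D a :=
    { toFun := fun P b => Connection.D L a (P b) - ∑ m, L.Γ m a b • P m
      map_zero' := by ext; simp
      map_add' := fun P Q => by
        ext b; simp only [Pi.add_apply, map_add, smul_add, Finset.sum_add_distrib]; abel }
  leibniz a r P := by
    ext b
    simp only [AddMonoidHom.coe_mk, ZeroHom.coe_mk, Pi.smul_apply, Pi.add_apply,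
      Connection.leibniz, smul_sub, Finset.smul_sum, smul_comm r]
    abel

/-- The covariant derivative in the direction of the `a`-th coordinate. -/
def D (a : ι) : N →+ N := Connection.D L a

/-- The covariant derivative. -/
def nabla (x : N) : ι → N := fun a => L.D a x

lemma nabla_apply (x : N) (a : ι) : L.nabla x a = L.D a x := rfl

lemma D_smul (a : ι) (r : A) (x : N) : L.D a (r • x) = L.d a r • x + r • L.D a x :=
  Connection.leibniz a r x

lemma D_scalar (a : ι) (x : A) : L.D a x = L.d a x := rfl

lemma D_apply (a : ι) (P : ι → N) (b : ι) :
    L.D a P b = L.D a (P b) - ∑ m, L.Γ m a b • P m := rfl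

/-- All lower indices receive the same kind of correction, so differentiation commutes with
permuting them. The variants below treat adjacent transpositions deeper in the index list. -/
lemma D_swap (a : ι) (P : ι → ι → N) (i j : ι) :
    L.D a (fun i j => P j i) i j = L.D a P j i := by
  simp only [D_apply, Pi.sub_apply, Finset.sum_apply, Pi.smul_apply]
  abel

lemma D_swap_inner (a : ι) (P : ι → ι → ι → N) (b i j : ι) :
    L.D a (fun b i j => P b j i) b i j = L.D a P b j i := by
  rw [D_apply, Pi.sub_apply, Pi.sub_apply, D_swap, D_apply L a P b]
  simp [Finset.sum_apply]

lemma D_swap_inner₂ (a : ι) (P : ι → ι → ι → ι → N) (c b i j : ι) :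
    L.D a (fun c b i j => P c b j i) c b i j = L.D a P c b j i := by
  rw [D_apply, Pi.sub_apply, Pi.sub_apply, Pi.sub_apply, D_swap_inner, D_apply L a P c]
  simp [Finset.sum_apply]

/-- The two Christoffel sums in `d_H` are, after renaming indices, the corrections of the two
contracted slots. -/
lemma D_tr (c : ι) (P : ι → ι → N) : L.D c (L.tr P) = L.tr (L.D c P) := by
  have h1 : L.D c (L.tr P) = ∑ a, ∑ b, (L.H a b • L.D c (P a b) -
      ∑ m, (L.Γ a c m * L.H m b + L.Γ b c m * L.H a m) • P a b) := by
    simp only [tr, map_sum, D_smul, d_H, neg_smul, Finset.sum_smul]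
    simp_rw [neg_add_eq_sub]
  rw [h1]
  simp only [tr, D_apply, Pi.sub_apply, Finset.sum_apply, Pi.smul_apply, smul_sub,
    Finset.sum_sub_distrib, add_smul, Finset.sum_add_distrib, Finset.smul_sum, smul_smul]
  have e1 : ∑ a, ∑ b, ∑ m, (L.Γ a c m * L.H m b) • P a b =
      ∑ a, ∑ b, ∑ m, (L.H a b * L.Γ m c a) • P m b := by
    calc _ = ∑ a, ∑ m, ∑ b, (L.Γ a c m * L.H m b) • P a b :=
          Finset.sum_congr rfl fun _ _ => Finset.sum_comm
      _ = ∑ m, ∑ a, ∑ b, (L.Γ a c m * L.H m b) • P a b := Finset.sum_comm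
      _ = ∑ m, ∑ b, ∑ a, (L.Γ a c m * L.H m b) • P a b :=
          Finset.sum_congr rfl fun _ _ => Finset.sum_comm
      _ = _ := by simp_rw [mul_comm]
  have e2 : ∑ a, ∑ b, ∑ m, (L.Γ b c m * L.H a m) • P a b =
      ∑ a, ∑ b, ∑ m, (L.H a b * L.Γ m c b) • P a m := by
    refine Finset.sum_congr rfl fun a _ => ?_
    rw [Finset.sum_comm]
    simp_rw [mul_comm]
  rw [e1, e2]
  abel

/-- The Leibniz rule passes from a bilinear map to its contraction over one more index; `D_dot`,
`D_inner₁` and `D_inner₂` follow by iterating. -/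
lemma D_pairing {β : N →ₗ[A] N' →ₗ[A] N''}
    (hβ : ∀ c x y, L.D c (β x y) = β (L.D c x) y + β x (L.D c y)) (c : ι) (x : ι → N)
    (y : ι → N') :
    L.D c (L.pairing β x y) = L.pairing β (L.D c x) y + L.pairing β x (L.D c y) := by
  simp only [pairing_apply, D_tr]
  rw [← tr_add]
  congr 1
  ext a b
  simp only [D_apply, Pi.sub_apply, Finset.sum_apply, Pi.smul_apply, hβ, map_sub, map_sum,
    map_smul, LinearMap.sub_apply, LinearMap.sum_apply, LinearMap.smul_apply]
  abel

lemma D_dot (c : ι) (f : ι → A) (T : ι → N) :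
    L.D c (L.dot f T) = L.dot (L.D c f) T + L.dot f (L.D c T) :=
  L.D_pairing (fun c x y => L.D_smul c x y) c f T

lemma D_inner₁ (c : ι) (S T : ι → A) :
    L.D c (L.inner₁ S T) = L.inner₁ (L.D c S) T + L.inner₁ S (L.D c T) :=
  L.D_pairing (fun c x y => L.D_smul c x y) c S T

lemma D_inner₂ (c : ι) (S T : ι → ι → A) :
    L.D c (L.inner₂ S T) = L.inner₂ (L.D c S) T + L.inner₂ S (L.D c T) :=
  L.D_pairing L.D_inner₁ c S T

lemma D_G (c : ι) : L.D c L.G = 0 := by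
  ext i j
  simp only [D_apply, Pi.sub_apply, Finset.sum_apply, Pi.smul_apply, D_scalar, L.compat,
    smul_eq_mul, Finset.sum_add_distrib, Pi.zero_apply]
  ring

end Connection

/-! ### Curvature, the Ricci identity and the Bianchi identities. -/

/-- The components `R^l_{kij}` of the curvature operator: the `l`-th coefficient of
`R(∂_i, ∂_j) ∂_k`. -/
def curv (l k i j : ι) : A :=
  L.d i (L.Γ l j k) - L.d j (L.Γ l i k) + ∑ m, (L.Γ l i m * L.Γ m j k - L.Γ l j m * L.Γ m i k)

/-- The Riemann curvature tensor. -/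
def riem (i j k l : ι) : A := ∑ m, L.G k m * L.curv m l i j

/-- The Ricci tensor. -/
def ric (j l : ι) : A := L.tr fun i k => L.riem i j k l

/-- The scalar curvature. -/
def scal : A := L.tr L.ric

section Commutator
variable [Connection L N]

/-- The Ricci identity for the outermost index. Here `a` and `b` are coordinate directions and not
tensor slots; for a tensor one peels off the indices one by one down to functions, where derivations
commute. -/
lemma commutator (P : ι → N) (a b c : ι) :
    L.D a (L.D b P) c - L.D b (L.D a P) c =
      L.D a (L.D b (P c)) - L.D b (L.D a (P c)) - ∑ m, L.curv m c a b • P m := by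
  simp only [D_apply, map_sub, map_sum, D_smul, curv, smul_sub, Finset.smul_sum, smul_smul,
    Finset.sum_sub_distrib, Finset.sum_add_distrib, add_smul, sub_smul, Finset.sum_smul]
  rw [Finset.sum_comm (f := fun i x => (L.Γ i a c * L.Γ x b i) • P x),
    Finset.sum_comm (f := fun i x => (L.Γ i b c * L.Γ x a i) • P x)]
  simp_rw [mul_comm (L.Γ _ a _) (L.Γ _ b _)]
  abel

/-- Absence of torsion: the Christoffel term of the derivative slot is symmetric and drops out on
skew-symmetrising. -/
lemma nabla_nabla_sub (x : N) (a b : ι) :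
    L.D a (L.nabla x) b - L.D b (L.nabla x) a = L.D a (L.D b x) - L.D b (L.D a x) := by
  simp only [D_apply, nabla_apply, L.Γ_symm _ a b]
  abel

end Commutator

lemma curv_skew (l k i j : ι) : L.curv l k i j = -L.curv l k j i := by
  simp only [curv, Finset.sum_sub_distrib]
  ring

lemma curv_cyclic (l k i j : ι) : L.curv l k i j + L.curv l i j k + L.curv l j k i = 0 := by
  simp only [curv, Finset.sum_sub_distrib, L.Γ_symm _ k, L.Γ_symm _ j i]
  ring

lemma riem_skew (i j k l : ι) : L.riem i j k l = -L.riem j i k l := by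
  simp only [riem, L.curv_skew _ _ i j, mul_neg, Finset.sum_neg_distrib]

/-- The Ricci identity applied to the parallel tensor g: the left side vanishes, and the two
curvature terms are lowered by g. -/
lemma riem_skew' (i j k l : ι) : L.riem i j k l = -L.riem i j l k := by
  have h := L.commutator L.G i j k
  have h' := congrFun h l
  simp only [D_G, map_zero, sub_zero, Pi.zero_apply, Pi.sub_apply, Finset.sum_apply,
    Pi.smul_apply] at h'
  have h2 := L.commutator (L.G k) i j l
  simp only [D_scalar, L.d_comm i j, sub_self, smul_eq_mul, zero_sub] at h2
  rw [h2] at h'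
  have e : ∀ i j k l, L.riem i j k l = ∑ m, L.curv m l i j * L.G k m := fun i j k l =>
    Finset.sum_congr rfl fun _ _ => mul_comm _ _
  rw [e, e]
  simp only [smul_eq_mul, L.G_symm _ l] at h'
  linear_combination h'

lemma riem_cyclic (i j k l : ι) : L.riem i j k l + L.riem j l k i + L.riem l i k j = 0 := by
  simp only [riem, ← Finset.sum_add_distrib, ← mul_add]
  refine Finset.sum_eq_zero fun m _ => ?_
  rw [L.curv_cyclic, mul_zero]

/-- The classical octahedron argument: four instances of the first Bianchi identity combine, by
skew-symmetry, to twice the difference. -/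
lemma riem_pair [Invertible (2 : A)] (i j k l : ι) : L.riem i j k l = L.riem k l i j := by
  have h2 : (2 : A) * (L.riem i j k l - L.riem k l i j) = 0 := by
    have h1 := L.riem_cyclic i j k l
    have h2 := L.riem_cyclic j k l i
    have h3 := L.riem_cyclic k l i j
    have h4 := L.riem_cyclic l i j k
    grind [L.riem_skew, L.riem_skew']
  have := congrArg (⅟(2 : A) * ·) h2
  simp only [mul_zero, invOf_mul_cancel_left] at this
  exact sub_eq_zero.mp this

lemma sum_H_riem (m c a b : ι) : ∑ k, L.H m k * L.riem a b k c = L.curv m c a b := by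
  simp only [riem, Finset.mul_sum, ← mul_assoc]
  rw [Finset.sum_comm]
  simp only [← Finset.sum_mul, sum_H_G]
  simp

lemma sum_curv_smul (P : ι → N) (c a b : ι) :
    ∑ m, L.curv m c a b • P m = L.tr fun m k => L.riem a b k c • P m := by
  simp only [tr, ← sum_H_riem, Finset.sum_smul, smul_smul]

/-- The second Bianchi identity. -/
lemma bianchi (e a b c k : ι) :
    L.D e L.riem a b c k + L.D a L.riem b e c k + L.D b L.riem e a c k = 0 := by
  -- Curvature as a matrix-valued 2-form R = dΓ + Γ∧Γ. The identity then reads dR + [Γ, R] = 0, a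
  -- noncommutative polynomial identity.
  let R : ι → ι → Matrix ι ι A := fun i j => Matrix.of fun l k => L.curv l k i j
  have hR : ∀ i j, R i j = (L.connMat j).map (L.d i) - (L.connMat i).map (L.d j) + (L.connMat i * L.connMat j - L.connMat j * L.connMat i) := by
    intro i j
    ext l k
    simp [R, connMat, curv, Matrix.mul_apply]
  have hDR : ∀ e a b, L.D e L.riem a b c k =
      (L.gMat * ((R a b).map (L.d e) + L.connMat e * R a b - R a b * L.connMat e)) c k
        - ∑ m, L.Γ m e a * L.riem m b c k - ∑ m, L.Γ m e b * L.riem a m c k := by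
    intro e a b
    have h1 : L.D e L.riem a b c k = L.d e (L.riem a b c k) - ∑ m, L.Γ m e k * L.riem a b c m
        - ∑ m, L.Γ m e c * L.riem a b m k - ∑ m, L.Γ m e b * L.riem a m c k
        - ∑ m, L.Γ m e a * L.riem m b c k := by
      simp only [D_apply, Pi.sub_apply, Finset.sum_apply, Pi.smul_apply, smul_eq_mul, D_scalar]
    have hr : ∀ c k, L.riem a b c k = (L.gMat * R a b) c k := fun c k => by
      simp [riem, R, gMat, Matrix.mul_apply]
    have h2 : L.d e (L.riem a b c k) = ((L.gMat * R a b).map (L.d e)) c k := by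
      rw [Matrix.map_apply, hr]
    have h3 : ∑ m, L.Γ m e k * L.riem a b c m = (L.gMat * R a b * L.connMat e) c k := by
      rw [Matrix.mul_apply]; simp [hr, connMat, mul_comm]
    have h4 : ∑ m, L.Γ m e c * L.riem a b m k = ((L.connMat e).transpose * (L.gMat * R a b)) c k := by
      rw [Matrix.mul_apply]; simp [hr, connMat]
    have h5 : (L.gMat * R a b).map (L.d e) - L.gMat * R a b * L.connMat e - (L.connMat e).transpose * (L.gMat * R a b)
        = L.gMat * ((R a b).map (L.d e) + L.connMat e * R a b - R a b * L.connMat e) := by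
      rw [d_matrix_mul, map_gMat]; noncomm_ring
    rw [h1, h2, h3, h4, ← h5]
    simp only [Matrix.sub_apply]
    ring
  have hdd : ∀ i j l, ((L.connMat l).map (L.d j)).map (L.d i) = ((L.connMat l).map (L.d i)).map (L.d j) := by
    intro i j l; ext; simp [L.d_comm i j]
  have hadd : ∀ i (M M' : Matrix ι ι A), (M + M').map (L.d i) = M.map (L.d i) + M'.map (L.d i) := by
    intro i M M'; ext; simp
  have hsub : ∀ i (M M' : Matrix ι ι A), (M - M').map (L.d i) = M.map (L.d i) - M'.map (L.d i) := by
    intro i M M'; ext; simp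
  have hcyc : ((R a b).map (L.d e) + L.connMat e * R a b - R a b * L.connMat e)
      + ((R b e).map (L.d a) + L.connMat a * R b e - R b e * L.connMat a)
      + ((R e a).map (L.d b) + L.connMat b * R e a - R e a * L.connMat b) = 0 := by
    simp only [hR, hadd, hsub, d_matrix_mul]
    rw [hdd e a, hdd e b, hdd a b]
    noncomm_ring
  have key := congrArg (fun M => (L.gMat * M) c k) hcyc
  simp only [mul_add, Matrix.add_apply, mul_zero, Matrix.zero_apply] at key
  -- The corrections on the two form indices cancel in the cyclic sum, since Γ is symmetric and the
  -- curvature skew.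
  have s1 : ∀ x y z, ∑ m, L.Γ m x y * L.riem m z c k = -∑ m, L.Γ m x y * L.riem z m c k := by
    intro x y z
    rw [← Finset.sum_neg_distrib]
    exact Finset.sum_congr rfl fun m _ => by rw [L.riem_skew]; ring
  rw [hDR, hDR, hDR, s1, s1, s1]
  simp only [L.Γ_symm _ b e, L.Γ_symm _ b a, L.Γ_symm _ a e]
  linear_combination key

end LeviCivita
end TensorCalculus

/-! ### The Ricci tensor of a gradient soliton. -/

namespace TensorCalculus

namespace LeviCivita

variable {A ι : Type*} [CommRing A] [Fintype ι] [DecidableEq ι] (L : LeviCivita A ι)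
variable {N : Type*} [AddCommGroup N] [Module A N] [Connection L N]

/-- The rough Laplacian. -/
def lap (x : N) : N := L.tr (L.nabla (L.nabla x))

lemma lap_eq (x : N) : L.lap x = L.tr fun a b => L.D a (L.nabla x) b := rfl

lemma D_rotate (a : ι) (P : ι → ι → ι → N) (b i j : ι) :
    L.D a (fun b i j => P j b i) b i j = L.D a P j b i := by
  have h1 := L.D_swap_inner a (fun b j i => P j b i) b i j
  have h2 := congrFun (L.D_swap a P b j) i
  exact h1.trans h2

lemma commutator_nabla₂ (S : ι → ι → A) (a b i j : ι) :
    L.D a (L.nabla S) b i j - L.D b (L.nabla S) a i j =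
      -L.tr (fun m k => L.riem a b k i * S m j) - L.tr (fun m k => L.riem a b k j * S i m) := by
  have h := congrFun (congrFun (L.nabla_nabla_sub S a b) i) j
  have h1 := congrFun (L.commutator S a b i) j
  have h2 := L.commutator (S i) a b j
  simp only [Pi.sub_apply] at h h1 h2
  rw [h, h1, h2, D_scalar, D_scalar, D_scalar, D_scalar, L.d_comm a b, sum_curv_smul,
    sum_curv_smul, tr_apply]
  simp only [Pi.smul_apply, smul_eq_mul]
  ring

lemma D_ric (k j l : ι) : L.D k L.ric j l = L.tr fun a b => L.D k L.riem a j b l := by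
  have h : L.ric = L.tr (fun a b j l => L.riem a j b l) := by
    ext j l
    rw [tr_apply, tr_apply, ric]
  rw [h, D_tr, tr_apply, tr_apply]
  congr 1
  ext a b
  exact congrFun (L.D_swap_inner k L.riem a b j) l

lemma D_riem_skew (a i j k l : ι) : L.D a L.riem i j k l = -L.D a L.riem j i k l := by
  have h : L.riem = -fun i j => L.riem j i := by
    ext i j k l; exact L.riem_skew i j k l
  conv_lhs => rw [h, map_neg]
  exact congrArg Neg.neg (congrFun (congrFun (L.D_swap a L.riem i j) k) l)

lemma D_riem_skew' (a i j k l : ι) : L.D a L.riem i j k l = -L.D a L.riem i j l k := by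
  have h : L.riem = -fun i j k l => L.riem i j l k := by
    ext i j k l; exact L.riem_skew' i j k l
  conv_lhs => rw [h, map_neg]
  exact congrArg Neg.neg (L.D_swap_inner₂ a L.riem i j k l)

/-- The second Bianchi identity contracted once. -/
lemma tr_D_riem (k j i : ι) :
    L.tr (fun a b => L.D a L.riem k j b i) = L.D k L.ric j i - L.D j L.ric k i := by
  rw [D_ric, D_ric, ← tr_sub]
  congr 1
  ext a b
  have := L.bianchi a k j b i
  rw [L.D_riem_skew k j a] at this
  linear_combination this

lemma tr_riem₁ (j l : ι) : L.tr (fun i k => L.riem i j k l) = L.ric j l := rfl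

lemma tr_riem₂ (i k : ι) : L.tr (fun j l => L.riem i j k l) = L.ric i k := by
  simp_rw [L.riem_skew i, L.riem_skew' _ i k, neg_neg]
  rfl

lemma tr_riem₃ (i l : ι) : L.tr (fun j k => L.riem i j k l) = -L.ric i l := by
  simp_rw [L.riem_skew i, tr_neg]
  rfl

lemma tr_riem₄ (j k : ι) : L.tr (fun i l => L.riem i j k l) = -L.ric j k := by
  simp_rw [L.riem_skew' _ _ k, tr_neg]
  rfl

section
variable [Invertible (2 : A)]

lemma ric_symm (i j : ι) : L.ric i j = L.ric j i := by
  rw [ric, ← tr_swap, ric]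
  simp_rw [L.riem_pair _ i]

lemma D_ric_symm (a i j : ι) : L.D a L.ric i j = L.D a L.ric j i := by
  have h : L.ric = fun i j => L.ric j i := by ext i j; exact L.ric_symm i j
  conv_lhs => rw [h]
  exact L.D_swap a L.ric i j

/-- The contracted second Bianchi identity. -/
lemma two_mul_div_ric (k : ι) : 2 * L.tr (fun a b => L.D a L.ric b k) = L.D k L.scal := by
  have h1 : L.tr (fun j i => L.tr fun a b => L.D a L.riem k j b i)
      = L.tr (fun a b => L.D a L.ric b k) := by
    rw [tr_tr]
    congr 1
    ext a b
    rw [L.D_ric_symm, D_ric]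
    congr 1
    ext j i
    rw [L.D_riem_skew, L.D_riem_skew', neg_neg]
  have h2 : L.tr (fun j i => L.D k L.ric j i) = L.D k L.scal := by
    rw [scal, D_tr]
  have h3 : L.tr (fun j i => L.D j L.ric k i) = L.tr (fun a b => L.D a L.ric b k) := by
    simp_rw [L.D_ric_symm _ k]
  simp_rw [tr_D_riem, tr_sub] at h1
  rw [h2, h3] at h1
  linear_combination -h1

end

section Soliton

variable {L} {f lam : A}

lemma ric_eq_of_soliton (hsol : ∀ i j, L.ric i j + L.D i (L.nabla f) j = lam * L.G i j) :
    L.ric = lam • L.G - L.nabla (L.nabla f) := by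
  ext i j
  simp only [Pi.sub_apply, Pi.smul_apply, smul_eq_mul, nabla_apply L (L.nabla f)]
  linear_combination hsol i j

variable [Invertible (2 : A)]

/-- As λg is parallel, ∇Ric = −∇³f, and skew-symmetrising ∇³f in its first two slots produces
curvature by the Ricci identity. -/
lemma codazzi (hlam : ∀ a, L.d a lam = 0)
    (hsol : ∀ i j, L.ric i j + L.D i (L.nabla f) j = lam * L.G i j) (a b c : ι) :
    L.D a L.ric b c - L.D b L.ric a c = L.dot (L.nabla f) L.riem c a b := by
  have hD : ∀ a, L.D a L.ric = - L.D a (L.nabla (L.nabla f)) := by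
    intro a
    rw [ric_eq_of_soliton hsol, map_sub, D_smul, hlam, D_G]
    simp
  rw [hD, hD]
  have h1 := congrFun (L.nabla_nabla_sub (L.nabla f) a b) c
  have h2 := L.commutator (L.nabla f) a b c
  simp only [Pi.sub_apply] at h1 h2
  rw [h2, D_scalar, D_scalar, D_scalar, D_scalar, L.d_comm a b, sum_curv_smul] at h1
  have h3 : L.dot (L.nabla f) L.riem c a b
      = L.tr fun m k => L.riem a b k c • L.nabla f m := by
    rw [dot_eq, tr_apply, tr_apply, tr_apply]
    congr 1
    ext m k
    simp only [Pi.smul_apply, smul_eq_mul, L.riem_pair k c]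
    ring
  rw [h3]
  simp only [Pi.neg_apply]
  linear_combination -h1

/-- Tracing `codazzi` gives div Ric − dR = −Ric(∇f); the contracted Bianchi identity eliminates dR =
2 div Ric. -/
lemma div_ric_of_soliton (hlam : ∀ a, L.d a lam = 0)
    (hsol : ∀ i j, L.ric i j + L.D i (L.nabla f) j = lam * L.G i j) (k : ι) :
    L.tr (fun a b => L.D a L.ric b k) = L.dot (L.nabla f) L.ric k := by
  have h1 : L.tr (fun a c => L.D a L.ric k c - L.D k L.ric a c)
      = L.tr (fun a c => L.dot (L.nabla f) L.riem c a k) := by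
    simp_rw [codazzi hlam hsol]
  have h2 : L.tr (fun a c => L.D k L.ric a c) = L.D k L.scal := by
    rw [scal, D_tr]
  have h3 : L.tr (fun a c => L.dot (L.nabla f) L.riem c a k) = -L.dot (L.nabla f) L.ric k := by
    simp only [dot_eq, tr_apply, Pi.smul_apply, smul_eq_mul]
    rw [tr_tr, ← tr_neg]
    congr 1
    ext a b
    rw [tr_mul_left, ← tr_swap]
    simp only [tr_riem₃]
    ring
  rw [tr_sub, h2, h3] at h1
  have h4 : L.tr (fun a c => L.D a L.ric k c) = L.tr (fun a b => L.D a L.ric b k) := by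
    congr 1; ext a b; exact L.D_ric_symm a k b
  rw [h4] at h1
  linear_combination L.two_mul_div_ric k - h1

/-- The equation for the Laplacian of the Ricci tensor of a gradient Ricci soliton. -/
lemma lap_ric (hlam : ∀ a, L.d a lam = 0)
    (hsol : ∀ i j, L.ric i j + L.D i (L.nabla f) j = lam * L.G i j) (i j : ι) :
    L.lap L.ric i j = L.dot (L.nabla f) (L.nabla L.ric) i j + 2 * lam * L.ric i j
      - 2 * L.inner₂ L.ric (fun k l => L.riem i k j l) := by
  -- Codazzi moves the derivative index into the tensor, so that after commuting derivatives the
  -- outer divergence falls on Ric itself.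
  have e0 : L.nabla L.ric = (fun b i j => L.nabla L.ric i b j)
      + fun b i j => L.dot (L.nabla f) L.riem j b i := by
    ext b i j
    simp only [Pi.add_apply, nabla_apply L L.ric]
    linear_combination codazzi hlam hsol b i j
  have e1 : ∀ a b, L.D a (L.nabla L.ric) b i j = L.D a (L.nabla L.ric) i b j
      + L.D a (L.dot (L.nabla f) L.riem) j b i := by
    intro a b
    conv_lhs => rw [e0, map_add]
    simp only [Pi.add_apply]
    rw [D_rotate L a (L.dot (L.nabla f) L.riem), congrFun (L.D_swap a (L.nabla L.ric) b i) j]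
  have e2 : L.tr (fun a b => L.D i (L.nabla L.ric) a b j)
      = L.D i (L.dot (L.nabla f) L.ric) j := by
    have h : L.dot (L.nabla f) L.ric = L.tr (L.nabla L.ric) := by
      ext k
      rw [tr_apply, ← div_ric_of_soliton hlam hsol]
      rfl
    rw [h, D_tr, tr_apply]
  have e3 : L.D i (L.dot (L.nabla f) L.ric) j = lam * L.ric i j
      - L.tr (fun a b => L.ric i a * L.ric b j) + L.dot (L.nabla f) (L.D i L.ric) j := by
    rw [D_dot, Pi.add_apply]
    congr 1
    have : L.D i (L.nabla f) = fun k => lam * L.G i k - L.ric i k := by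
      ext k; linear_combination hsol i k
    rw [this, dot_apply, dot_eq]
    have h1 : (fun a b => (lam * L.G i a - L.ric i a) • L.ric b j)
        = fun a b => lam * (L.G i a * L.ric b j) - L.ric i a * L.ric b j := by
      ext a b; rw [smul_eq_mul]; ring
    rw [h1, tr_sub, tr_mul_left, tr_G_mul]
  -- This Ric² term from commuting derivatives cancels the one in `e3`.
  have e4 : L.tr (fun a b => L.tr (fun m k => L.riem a i k b * L.ric m j))
      = -L.tr (fun k m => L.ric i k * L.ric m j) := by
    rw [tr_tr, ← tr_swap, ← tr_neg]
    congr 1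
    ext k m
    rw [tr_mul_right, tr_riem₄, neg_mul]
  have e5 : L.tr (fun a b => L.tr (fun m k => L.riem a i k j * L.ric b m))
      = L.inner₂ L.ric (fun k l => L.riem i k j l) := by
    rw [← tr_swap, inner₂_eq]
    congr 1
    ext a b
    congr 1
    ext m k
    rw [L.riem_skew b, L.riem_skew' i b, neg_neg, mul_comm]
  -- Divergence of the Codazzi term: ∇²f is replaced by λg − Ric, and `tr_D_riem` evaluates the
  -- divergence of Rm.
  have e6 : L.tr (fun a b => L.D a (L.dot (L.nabla f) L.riem) j b i)
      = lam * L.ric j i - L.inner₂ L.ric (fun k l => L.riem i k j l)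
        + L.dot (L.nabla f) (fun k => L.D k L.ric j i - L.D j L.ric k i) := by
    have h1 : ∀ a b, L.D a (L.dot (L.nabla f) L.riem) j b i
        = lam * L.tr (fun k l => L.G a k * L.riem l j b i)
          - L.tr (fun k l => L.ric a k * L.riem l j b i)
          + L.dot (L.nabla f) (fun k => L.D a L.riem k j b i) := by
      intro a b
      have : L.D a (L.nabla f) = fun k => lam * L.G a k - L.ric a k := by
        ext k; linear_combination hsol a k
      rw [D_dot, this]
      simp only [Pi.add_apply, dot_apply]
      simp only [dot_eq, smul_eq_mul, sub_mul, mul_assoc]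
      rw [tr_sub, tr_mul_left]
    simp_rw [h1, tr_add, tr_sub, tr_mul_left, tr_G_mul, tr_dot, tr_D_riem]
    congr 2
    rw [inner₂_eq]
    congr 1
    ext a b
    congr 1
    ext m k
    rw [L.riem_pair k, L.riem_skew b, L.riem_skew' i b, neg_neg]
  -- By Codazzi this is f^k f^l R_lkij, a symmetric product contracted with a skew pair.
  have e7 : L.dot (L.nabla f) (fun k => L.D i L.ric k j - L.D j L.ric k i) = 0 := by
    have h1 : ∀ k, L.D i L.ric k j - L.D j L.ric k i
        = L.dot (L.nabla f) (fun l => L.riem l k i j) := by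
      intro k
      have := codazzi hlam hsol i j k
      simp only [dot_apply] at this
      rw [L.D_ric_symm _ k, L.D_ric_symm _ k, this]
    simp_rw [h1]
    have h2 : L.dot (L.nabla f) (fun k => L.dot (L.nabla f) fun l => L.riem l k i j)
        = -L.dot (L.nabla f) (fun k => L.dot (L.nabla f) fun l => L.riem l k i j) := by
      simp only [dot_eq, ← tr_smul]
      conv_lhs => rw [tr_tr]
      rw [← tr_neg]
      congr 1
      ext a b
      rw [← tr_neg]
      congr 1
      ext k l
      rw [L.riem_skew b l]
      simp only [smul_eq_mul]
      ring
    have h3 : (2 : A) * L.dot (L.nabla f) (fun k => L.dot (L.nabla f) fun l => L.riem l k i j)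
        = 0 := by linear_combination h2
    simpa using congrArg (⅟(2 : A) * ·) h3
  have e8 : ∀ a b, L.D a (L.nabla L.ric) i b j = L.D i (L.nabla L.ric) a b j
      - L.tr (fun m k => L.riem a i k b * L.ric m j)
      - L.tr (fun m k => L.riem a i k j * L.ric b m) := by
    intro a b
    linear_combination L.commutator_nabla₂ L.ric a i b j
  rw [lap_eq, tr_apply, tr_apply]
  simp_rw [e1, e8, tr_add, tr_sub]
  rw [e2, e3, e4, e5, e6, L.ric_symm j i]
  -- The first-order terms of `e3` and `e6` add up to ∇_{∇f}Ric plus the expression that `e7` kills.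
  have e9 : L.dot (L.nabla f) (L.D i L.ric) j
      + L.dot (L.nabla f) (fun k => L.D k L.ric j i - L.D j L.ric k i)
      = L.dot (L.nabla f) (L.nabla L.ric) i j
      + L.dot (L.nabla f) (fun k => L.D i L.ric k j - L.D j L.ric k i) := by
    simp only [dot_apply, ← map_add]
    congr 1
    ext k
    simp only [Pi.add_apply, nabla_apply, L.D_ric_symm k j i]
    ring
  linear_combination e9 + e7

end Soliton
end LeviCivita
end TensorCalculus

/-! ### The Bochner formula for the weighted Einstein tensor. -/

namespace TensorCalculus

namespace LeviCivita

variable {A ι : Type*} [CommRing A] [Fintype ι] [DecidableEq ι] (L : LeviCivita A ι)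

section
variable {N : Type*} [AddCommGroup N] [Module A N] [Connection L N]

lemma D_tensor (a : ι) (u : ι → A) (x : N) (b : ι) :
    L.D a (fun b => u b • x) b = L.D a u b • x + u b • L.D a x := by
  simp only [D_apply, D_smul, D_scalar, smul_eq_mul, sub_smul, Finset.sum_smul, smul_smul]
  abel

lemma nabla_sub (x y : N) : L.nabla (x - y) = L.nabla x - L.nabla y := by
  ext a; simp [nabla_apply]

lemma nabla_smul (r : A) (x : N) :
    L.nabla (r • x) = (fun b => L.nabla r b • x) + r • L.nabla x := by
  ext a; simp [nabla_apply, D_smul, D_scalar]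

lemma lap_sub (x y : N) : L.lap (x - y) = L.lap x - L.lap y := by
  rw [lap, nabla_sub, nabla_sub]
  exact L.tr_sub _ _

lemma lap_smul (r : A) (x : N) :
    L.lap (r • x) = L.lap r • x + (2 : A) • L.dot (L.nabla r) (L.nabla x) + r • L.lap x := by
  have h : ∀ a b, L.D a (L.nabla (r • x)) b = L.D a (L.nabla r) b • x
      + L.nabla r b • L.nabla x a + L.nabla r a • L.nabla x b
      + r • L.D a (L.nabla x) b := by
    intro a b
    rw [nabla_smul, map_add, Pi.add_apply, D_tensor, D_smul]
    simp only [Pi.add_apply, Pi.smul_apply, nabla_apply, D_scalar]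
    abel
  have h1 : L.tr (fun a b => L.D a (L.nabla r) b • x) = L.lap r • x := by
    simp [lap_eq, tr, Finset.sum_smul, smul_smul]
  have h2 : L.tr (fun a b => L.nabla r b • L.nabla x a)
      = L.tr (fun a b => L.nabla r a • L.nabla x b) :=
    L.tr_swap fun a b => L.nabla r a • L.nabla x b
  rw [lap_eq]
  simp_rw [h, tr_add]
  rw [h1, h2, tr_smul, dot_eq, two_smul, ← add_assoc]
  rfl

lemma nabla_const_smul {r : A} (hr : ∀ a, L.d a r = 0) (x : N) :
    L.nabla (r • x) = r • L.nabla x := by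
  ext a
  rw [nabla_apply, D_smul, hr, zero_smul, zero_add]
  rfl

lemma lap_const_smul {r : A} (hr : ∀ a, L.d a r = 0) (x : N) :
    L.lap (r • x) = r • L.lap x := by
  rw [lap, nabla_const_smul L hr, nabla_const_smul L hr]
  exact L.tr_smul _ _

end

lemma dot_smul_right {N : Type*} [AddCommGroup N] [Module A N] (f u : ι → A) (x : N) :
    L.dot f (fun b => u b • x) = L.dot f u • x := by
  simp [dot_eq, tr, Finset.sum_smul, smul_smul]

lemma inner₂_dot (f : ι → A) (E : ι → ι → A) (X : ι → ι → ι → A) :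
    L.inner₂ E (L.dot f X) = L.dot f fun k => L.inner₂ E (X k) := by
  rw [dot_eq, map_tr]
  simp [dot_eq]

lemma d_two (a : ι) : L.d a 2 = 0 := by
  simpa using (L.d a).map_natCast 2

lemma d_invOf_two [Invertible (2 : A)] (a : ι) : L.d a (⅟2 : A) = 0 := by
  have h := congrArg (L.d a) (mul_invOf_self (2 : A))
  rw [Derivation.leibniz, d_two, Derivation.map_one_eq_zero, smul_zero, add_zero] at h
  have h2 := congrArg (⅟(2 : A) * ·) h
  simpa using h2

lemma nabla_G : L.nabla L.G = 0 := by
  ext1 a; exact L.D_G a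

lemma lap_G : L.lap L.G = 0 := by
  rw [lap, nabla_G, tr]
  simp [nabla]

/-- The squared norm of the covariant derivative. -/
def nablaSq (E : ι → ι → A) : A := L.pairing L.inner₂ (L.nabla E) (L.nabla E)

lemma nabla_normSq (E : ι → ι → A) (b : ι) :
    L.nabla (L.inner₂ E E) b = 2 * L.inner₂ E (L.nabla E b) := by
  rw [nabla_apply, D_inner₂, inner₂_comm, two_mul]
  rfl

/-- The Bochner formula for a symmetric 2-tensor. -/
lemma lap_normSq (E : ι → ι → A) :
    L.lap (L.inner₂ E E) = 2 * L.nablaSq E + 2 * L.inner₂ E (L.lap E) := by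
  have h : ∀ a b, L.D a (L.nabla (L.inner₂ E E)) b
      = 2 * L.inner₂ (L.nabla E a) (L.nabla E b) + 2 * L.inner₂ E (L.D a (L.nabla E) b) := by
    intro a b
    simp only [D_apply, nabla_normSq, D_scalar, Derivation.leibniz, d_two, smul_eq_mul, map_sub,
      map_sum, map_smul, mul_sub, Finset.mul_sum]
    rw [← D_scalar, D_inner₂]
    simp_rw [mul_left_comm (2 : A)]
    simp only [nabla_apply]
    ring
  rw [lap_eq]
  simp_rw [h, tr_add, tr_mul_left]
  rw [nablaSq, pairing_apply, lap_eq, map_tr]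

lemma lap_tr (S : ι → ι → A) : L.lap (L.tr S) = L.tr (L.lap S) := by
  have h : ∀ a b, L.D a (L.nabla (L.tr S)) b = L.tr (L.D a (L.nabla S) b) := by
    intro a b
    have h1 : L.nabla (L.tr S) = L.tr (fun i j b => L.nabla S b i j) := by
      ext b
      rw [tr_apply, nabla_apply, D_tr]
      rfl
    rw [h1, D_tr, tr_apply]
    congr 1
    ext i j
    have h2 := L.D_swap_inner a (fun i b j => L.nabla S b i j) i j b
    have h3 := congrFun (L.D_swap a (L.nabla S) i b) j
    exact h2.trans h3
  rw [lap_eq]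
  simp_rw [h]
  have : L.lap S = fun i j => L.tr fun a b => L.D a (L.nabla S) b i j := by
    ext i j; rw [lap_eq, tr_apply, tr_apply]
  rw [this, tr_tr]

/-- The action of the curvature on 2-tensors. -/
def rmAct (S : ι → ι → A) (i j : ι) : A := L.inner₂ S fun k l => L.riem i k j l

lemma rmAct_sub (S T : ι → ι → A) : L.rmAct (S - T) = L.rmAct S - L.rmAct T := by
  ext i j; simp [rmAct]

lemma rmAct_smul (r : A) (S : ι → ι → A) : L.rmAct (r • S) = r • L.rmAct S := by
  ext i j; simp [rmAct]

lemma rmAct_G : L.rmAct L.G = L.ric := by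
  ext i j
  rw [rmAct, inner₂_G, tr_riem₂]

lemma tr_rmAct (S : ι → ι → A) : L.tr (L.rmAct S) = L.inner₂ S L.ric := by
  have : L.ric = L.tr (fun i j k l => L.riem i k j l) := by
    ext k l; rw [tr_apply, tr_apply]; rfl
  rw [this, map_tr]
  rfl

lemma tr_G : L.tr L.G = (Fintype.card ι : A) := by
  have h : ∀ i, ∑ j, L.H i j * L.G i j = 1 := by
    intro i
    have := L.sum_H_G i i
    simpa [L.G_symm _ i] using this
  simp [tr, h]

section Soliton

variable {L} {f lam w : A} [Invertible (2 : A)]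

/-- The trace of `lap_ric`; by `tr_rmAct` the curvature term traces to |Ric|². -/
lemma lap_scal (hlam : ∀ a, L.d a lam = 0)
    (hsol : ∀ i j, L.ric i j + L.D i (L.nabla f) j = lam * L.G i j) :
    L.lap L.scal = L.dot (L.nabla f) (L.nabla L.scal) + 2 * lam * L.scal
      - 2 * L.inner₂ L.ric L.ric := by
  have h : L.lap L.ric = fun i j => L.dot (L.nabla f) (L.nabla L.ric) i j + 2 * lam * L.ric i j
      - 2 * L.rmAct L.ric i j := by
    ext i j; exact lap_ric hlam hsol i j
  have h1 : L.tr (L.dot (L.nabla f) (L.nabla L.ric)) = L.dot (L.nabla f) (L.nabla L.scal) := by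
    have h3 : L.nabla L.scal = fun k => L.tr (L.nabla L.ric k) := by
      ext k; rw [nabla_apply, scal, D_tr]; rfl
    rw [h3, ← tr_dot]
    congr 1
    ext i j
    rw [dot_apply, dot_apply]
  have h2 := L.tr_rmAct L.ric
  rw [← h1, ← h2, scal, lap_tr, h, tr_sub, tr_add, tr_mul_left, tr_mul_left]

/-- The weighted Einstein tensor with weight `w`. -/
def einstein (L : LeviCivita A ι) (w : A) : ι → ι → A := w • (L.ric - (⅟2 * L.scal) • L.G)

/-- With B = Ric − ½R g, the Laplacian of w contributes wR B, while passing from Rm(Ric) to Rm(B)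
contributes −wR Ric. Their sum is −½wR² g, so only a multiple of g is left over. The weight enters
through dw = −w df alone. -/
lemma lap_einstein (hlam : ∀ a, L.d a lam = 0)
    (hsol : ∀ i j, L.ric i j + L.D i (L.nabla f) j = lam * L.G i j)
    (hw : ∀ a, L.d a w = -(w * L.d a f)) :
    L.lap (L.einstein w) = -L.dot (L.nabla f) (L.nabla (L.einstein w))
      - (((Fintype.card ι : A) - 2) * lam) • L.einstein w - (2 : A) • L.rmAct (L.einstein w)
      + (w * (L.inner₂ L.ric L.ric - ⅟2 * L.scal ^ 2)) • L.G := by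
  have hhalf : (2 : A) * ⅟2 = 1 := mul_invOf_self 2
  set B : ι → ι → A := L.ric - (⅟2 * L.scal) • L.G with hB
  have hnw : L.nabla w = -(w • L.nabla f) := by
    ext a
    exact hw a
  have hlapf : L.lap f = (Fintype.card ι : A) * lam - L.scal := by
    have : L.nabla (L.nabla f) = fun i j => lam * L.G i j - L.ric i j := by
      ext i j; rw [nabla_apply]; linear_combination hsol i j
    rw [lap, this, tr_sub, tr_mul_left, tr_G, scal]
    ring
  have hlapw : L.lap w = w * (L.dot (L.nabla f) (L.nabla f) - L.lap f) := by
    have h : ∀ a b, L.D a (L.nabla w) b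
        = w * (L.nabla f a * L.nabla f b) - w * L.D a (L.nabla f) b := by
      intro a b
      rw [hnw, map_neg, D_smul, hw]
      simp only [Pi.neg_apply, Pi.add_apply, Pi.smul_apply, smul_eq_mul, nabla_apply L f,
        D_scalar]
      ring
    rw [lap_eq]
    simp_rw [h, tr_sub, tr_mul_left]
    rw [mul_sub]
    rfl
  have hlapB : L.lap B = L.dot (L.nabla f) (L.nabla B) + (2 * lam) • B - (2 : A) • L.rmAct L.ric
      + L.inner₂ L.ric L.ric • L.G := by
    have h1 : L.lap L.ric = L.dot (L.nabla f) (L.nabla L.ric) + (2 * lam) • L.ric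
        - (2 : A) • L.rmAct L.ric := by
      ext i j; exact lap_ric hlam hsol i j
    have h2 : L.lap ((⅟2 * L.scal) • L.G) = (⅟2 * L.lap L.scal) • L.G := by
      rw [lap_smul, lap_G, nabla_G, ← smul_eq_mul (⅟2 : A) L.scal, L.lap_const_smul L.d_invOf_two]
      simp
    have h3 : L.dot (L.nabla f) (L.nabla ((⅟2 * L.scal) • L.G))
        = (⅟2 * L.dot (L.nabla f) (L.nabla L.scal)) • L.G := by
      rw [nabla_smul, nabla_G, smul_zero, add_zero, dot_smul_right, ← smul_eq_mul (⅟2 : A) L.scal,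
        L.nabla_const_smul L.d_invOf_two, map_smul, smul_eq_mul]
    rw [hB, lap_sub, h1, h2, nabla_sub, map_sub, h3, lap_scal hlam hsol]
    ext i j
    simp only [Pi.sub_apply, Pi.add_apply, Pi.smul_apply, smul_eq_mul]
    linear_combination (L.inner₂ L.ric L.ric * L.G i j) * hhalf
  have hdot : L.dot (L.nabla f) (L.nabla (w • B))
      = -(w * L.dot (L.nabla f) (L.nabla f)) • B + w • L.dot (L.nabla f) (L.nabla B) := by
    rw [nabla_smul, map_add, dot_smul_right, map_smul, hnw, map_neg, map_smul, smul_eq_mul]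
  have hRm : L.rmAct (w • B) = w • (L.rmAct L.ric - (⅟2 * L.scal) • L.ric) := by
    rw [rmAct_smul, hB, rmAct_sub, rmAct_smul, rmAct_G]
  have hric : L.ric = B + (⅟2 * L.scal) • L.G := by rw [hB, sub_add_cancel]
  rw [einstein, ← hB, hdot, hRm, lap_smul, hlapw, hlapf, hnw, hlapB, map_neg, map_smul]
  ext i j
  have hij : L.ric i j = B i j + ⅟2 * L.scal * L.G i j := congrFun (congrFun hric i) j
  simp only [Pi.sub_apply, Pi.add_apply, Pi.smul_apply, Pi.neg_apply, LinearMap.neg_apply,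
    LinearMap.smul_apply, smul_eq_mul]
  linear_combination -(w * L.scal) * hij - (w * L.scal * L.ric i j) * hhalf

/-- The Bochner formula for the weighted Einstein tensor of a gradient Ricci soliton. -/
theorem lap_normSq_einstein (hlam : ∀ a, L.d a lam = 0)
    (hsol : ∀ i j, L.ric i j + L.D i (L.nabla f) j = lam * L.G i j)
    (hw : ∀ a, L.d a w = -(w * L.d a f)) :
    L.lap (L.inner₂ (L.einstein w) (L.einstein w)) = 2 * L.nablaSq (L.einstein w)
      - L.inner₁ (L.nabla (L.inner₂ (L.einstein w) (L.einstein w))) (L.nabla f)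
      - 2 * ((Fintype.card ι : A) - 2) * lam * L.inner₂ (L.einstein w) (L.einstein w)
      - 4 * L.inner₂ (L.einstein w) (L.rmAct (L.einstein w))
      - ((Fintype.card ι : A) - 2) * L.scal * L.inner₂ (L.einstein w) (L.einstein w)
      + L.scal * L.tr (L.einstein w) ^ 2 := by
  have hhalf : (2 : A) * ⅟2 = 1 := mul_invOf_self 2
  have h1 : L.inner₁ (L.nabla (L.inner₂ (L.einstein w) (L.einstein w))) (L.nabla f)
      = 2 * L.inner₂ (L.einstein w) (L.dot (L.nabla f) (L.nabla (L.einstein w))) := by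
    rw [inner₂_dot, inner₁_comm]
    change L.dot _ _ = _
    have : L.nabla (L.inner₂ (L.einstein w) (L.einstein w))
        = (2 : A) • fun k => L.inner₂ (L.einstein w) (L.nabla (L.einstein w) k) := by
      ext b; exact L.nabla_normSq _ b
    rw [this, map_smul, smul_eq_mul]
  have h2 : L.inner₂ (L.einstein w) L.G = L.tr (L.einstein w) := by
    rw [inner₂_comm, inner₂_G]
  have h3 : L.tr (L.einstein w) = w * (L.scal - ⅟2 * L.scal * (Fintype.card ι : A)) := by
    have h5 : L.inner₂ L.G L.ric = L.scal := by rw [inner₂_G, scal]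
    have h6 : L.inner₂ L.G L.G = (Fintype.card ι : A) := by rw [inner₂_G, tr_G]
    rw [← inner₂_G]
    simp only [einstein, map_smul, map_sub, smul_eq_mul, h5, h6]
  -- Here w²(|Ric|² − ½R²) = |E|² − ¼(n − 2)w²R². Multiplied by tr E = −½(n − 2)wR, divided by w,
  -- this gives the last two terms without dividing by n − 2.
  have h4 : L.inner₂ (L.einstein w) (L.einstein w) = w ^ 2 * (L.inner₂ L.ric L.ric
      - L.scal ^ 2 + (⅟2 * L.scal) ^ 2 * (Fintype.card ι : A)) := by
    have h5 : L.inner₂ L.ric L.G = L.scal := by rw [inner₂_comm, inner₂_G, scal]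
    have h6 : L.inner₂ L.G L.ric = L.scal := by rw [inner₂_G, scal]
    have h7 : L.inner₂ L.G L.G = (Fintype.card ι : A) := by rw [inner₂_G, tr_G]
    simp only [einstein, map_smul, map_sub, LinearMap.smul_apply, LinearMap.sub_apply, smul_eq_mul,
      h5, h6, h7]
    linear_combination (-w ^ 2 * L.scal ^ 2) * hhalf
  rw [lap_normSq, lap_einstein hlam hsol hw, h1]
  simp only [map_sub, map_add, map_neg, map_smul, smul_eq_mul, h2]
  rw [h3, h4]
  linear_combination (-(w ^ 2 * L.scal * ((Fintype.card ι : A) * L.inner₂ L.ric L.ric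
    + (1 - (Fintype.card ι : A)) * L.scal ^ 2))) * hhalf

end Soliton
end LeviCivita
end TensorCalculus

/-! ### Dimension three: curvature in terms of Ricci. -/

namespace TensorCalculus

lemma skew_fin_three_eq_zero {A : Type*} [CommRing A] [Invertible (2 : A)] (B : Fin 3 → Fin 3 → A)
    (h : ∀ i j, B i j = -B j i) (h01 : B 0 1 = 0) (h02 : B 0 2 = 0) (h12 : B 1 2 = 0)
    (i j : Fin 3) : B i j = 0 := by
  have hd : ∀ i, B i i = 0 := by
    intro i
    have h2 : (2 : A) * B i i = 0 := by linear_combination h i i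
    simpa using congrArg (⅟(2 : A) * ·) h2
  fin_cases i <;> fin_cases j <;> simp [hd, h01, h02, h12, h 1 0, h 2 0, h 2 1]

/-- In dimension three, an algebraic curvature tensor without Ricci curvature vanishes. -/
lemma curvature_fin_three_eq_zero {A : Type*} [CommRing A] [Invertible (2 : A)]
    (H : Fin 3 → Fin 3 → A) (hH : ∀ i j, H i j = H j i) (hdet : IsUnit (Matrix.of H).det)
    (W : Fin 3 → Fin 3 → Fin 3 → Fin 3 → A)
    (h1 : ∀ i j k l, W i j k l = -W j i k l) (h2 : ∀ i j k l, W i j k l = -W i j l k)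
    (h3 : ∀ i j k l, W i j k l = W k l i j)
    (hric : ∀ j l, ∑ i, ∑ k, H i k * W i j k l = 0) (i j k l : Fin 3) : W i j k l = 0 := by
  have hd1 : ∀ i k l, W i i k l = 0 := by
    intro i k l
    have h : (2 : A) * W i i k l = 0 := by linear_combination h1 i i k l
    simpa using congrArg (⅟(2 : A) * ·) h
  have hd2 : ∀ i k l, W k l i i = 0 := fun i k l => by rw [h3, hd1]
  have r00 := hric 0 0
  have r01 := hric 0 1
  have r02 := hric 0 2
  have r11 := hric 1 1
  have r12 := hric 1 2
  have r22 := hric 2 2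
  simp only [Fin.sum_univ_three, hd1, hd2, h1 1 0, h1 2 0, h1 2 1, h2 _ _ 1 0, h2 _ _ 2 0,
    h2 _ _ 2 1, h3 0 2 0 1, h3 1 2 0 1, h3 1 2 0 2, hH 1 0, hH 2 0, hH 2 1]
    at r00 r01 r02 r11 r12 r22
  have hcancel : ∀ x : A, 2 * (Matrix.of H).det * x = 0 → x = 0 := by
    intro x hx
    have h4 : (Matrix.of H).det * x = 0 := by
      have := congrArg (⅟(2 : A) * ·) hx
      simpa [mul_assoc] using this
    exact (hdet.mul_right_eq_zero).mp h4
  have hdet' := Matrix.det_fin_three (Matrix.of H)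
  simp only [Matrix.of_apply, hH 1 0, hH 2 0, hH 2 1] at hdet'
  rw [hdet'] at hcancel
  -- `H` plays the inverse metric. With r the Ricci contraction and s its trace, each entry of s H −
  -- 2 H r H is, up to sign, 2 det H times one of the six independent components of `W`; this is the
  -- raised Einstein tensor, and it inverts the Ricci contraction.
  have e22 : W 0 1 0 1 = 0 := by
    apply hcancel
    linear_combination
      H 2 2 * (H 0 0 * r00 + H 0 1 * 2 * r01 + H 0 2 * 2 * r02 + H 1 1 * r11 + H 1 2 * 2 * r12 + H 2 2 * r22)
      - 2 * (H 0 2 * H 0 2 * r00 + (H 0 2 * H 1 2 + H 1 2 * H 0 2) * r01 + (H 0 2 * H 2 2 + H 2 2 * H 0 2) * r02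
        + H 1 2 * H 1 2 * r11 + (H 1 2 * H 2 2 + H 2 2 * H 1 2) * r12 + H 2 2 * H 2 2 * r22)
  have e12 : W 0 1 0 2 = 0 := by
    apply hcancel
    linear_combination
      -H 1 2 * (H 0 0 * r00 + H 0 1 * 2 * r01 + H 0 2 * 2 * r02 + H 1 1 * r11 + H 1 2 * 2 * r12 + H 2 2 * r22)
      + 2 * (H 0 1 * H 0 2 * r00 + (H 0 1 * H 1 2 + H 1 1 * H 0 2) * r01 + (H 0 1 * H 2 2 + H 1 2 * H 0 2) * r02
        + H 1 1 * H 1 2 * r11 + (H 1 1 * H 2 2 + H 1 2 * H 1 2) * r12 + H 1 2 * H 2 2 * r22)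
  have e02 : W 0 1 1 2 = 0 := by
    apply hcancel
    linear_combination
      H 0 2 * (H 0 0 * r00 + H 0 1 * 2 * r01 + H 0 2 * 2 * r02 + H 1 1 * r11 + H 1 2 * 2 * r12 + H 2 2 * r22)
      - 2 * (H 0 0 * H 0 2 * r00 + (H 0 0 * H 1 2 + H 0 1 * H 0 2) * r01 + (H 0 0 * H 2 2 + H 0 2 * H 0 2) * r02
        + H 0 1 * H 1 2 * r11 + (H 0 1 * H 2 2 + H 0 2 * H 1 2) * r12 + H 0 2 * H 2 2 * r22)
  have e11 : W 0 2 0 2 = 0 := by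
    apply hcancel
    linear_combination
      H 1 1 * (H 0 0 * r00 + H 0 1 * 2 * r01 + H 0 2 * 2 * r02 + H 1 1 * r11 + H 1 2 * 2 * r12 + H 2 2 * r22)
      - 2 * (H 0 1 * H 0 1 * r00 + (H 0 1 * H 1 1 + H 1 1 * H 0 1) * r01 + (H 0 1 * H 1 2 + H 1 2 * H 0 1) * r02
        + H 1 1 * H 1 1 * r11 + (H 1 1 * H 1 2 + H 1 2 * H 1 1) * r12 + H 1 2 * H 1 2 * r22)
  have e01 : W 0 2 1 2 = 0 := by
    apply hcancel
    linear_combination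
      -H 0 1 * (H 0 0 * r00 + H 0 1 * 2 * r01 + H 0 2 * 2 * r02 + H 1 1 * r11 + H 1 2 * 2 * r12 + H 2 2 * r22)
      + 2 * (H 0 0 * H 0 1 * r00 + (H 0 0 * H 1 1 + H 0 1 * H 0 1) * r01 + (H 0 0 * H 1 2 + H 0 2 * H 0 1) * r02
        + H 0 1 * H 1 1 * r11 + (H 0 1 * H 1 2 + H 0 2 * H 1 1) * r12 + H 0 2 * H 1 2 * r22)
  have e00 : W 1 2 1 2 = 0 := by
    apply hcancel
    linear_combination
      H 0 0 * (H 0 0 * r00 + H 0 1 * 2 * r01 + H 0 2 * 2 * r02 + H 1 1 * r11 + H 1 2 * 2 * r12 + H 2 2 * r22)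
      - 2 * (H 0 0 * H 0 0 * r00 + (H 0 0 * H 0 1 + H 0 1 * H 0 0) * r01 + (H 0 0 * H 0 2 + H 0 2 * H 0 0) * r02
        + H 0 1 * H 0 1 * r11 + (H 0 1 * H 0 2 + H 0 2 * H 0 1) * r12 + H 0 2 * H 0 2 * r22)
  refine skew_fin_three_eq_zero (fun i j => W i j k l) (fun i j => h1 i j k l) ?_ ?_ ?_ i j
  · exact skew_fin_three_eq_zero (fun k l => W 0 1 k l) (fun k l => h2 0 1 k l) e22 e12 e02 k l
  · exact skew_fin_three_eq_zero (fun k l => W 0 2 k l) (fun k l => h2 0 2 k l)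
      ((h3 _ _ _ _).trans e12) e11 e01 k l
  · exact skew_fin_three_eq_zero (fun k l => W 1 2 k l) (fun k l => h2 1 2 k l)
      ((h3 _ _ _ _).trans e02) ((h3 _ _ _ _).trans e01) e00 k l

namespace LeviCivita

variable {A ι : Type*} [CommRing A] [Fintype ι] [DecidableEq ι] (L : LeviCivita A ι)

/-- The square of a 2-tensor. -/
def sq (S : ι → ι → A) (i j : ι) : A := L.tr fun a b => S i a * S b j

lemma inner₂_ric_G : L.inner₂ L.ric L.G = L.scal := by rw [inner₂_comm, inner₂_G, scal]

lemma inner₂_G_G : L.inner₂ L.G L.G = (Fintype.card ι : A) := by rw [inner₂_G, tr_G]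

/-- A general `s` serves both tensors: s = R/2 for the Einstein tensor and s = R/n for the traceless
Ricci tensor. -/
lemma normSq_ric_sub (s : A) :
    L.inner₂ (L.ric - s • L.G) (L.ric - s • L.G)
      = L.inner₂ L.ric L.ric - 2 * s * L.scal + s ^ 2 * (Fintype.card ι : A) := by
  simp only [map_smul, map_sub, LinearMap.smul_apply, LinearMap.sub_apply, smul_eq_mul,
    inner₂_ric_G, inner₂_G_G, L.inner₂_comm L.G L.ric]
  ring

lemma rmPair_ric_sub (s : A) :
    L.inner₂ (L.ric - s • L.G) (L.rmAct (L.ric - s • L.G))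
      = L.inner₂ L.ric (L.rmAct L.ric) - 2 * s * L.inner₂ L.ric L.ric + s ^ 2 * L.scal := by
  have h : L.inner₂ L.G (L.rmAct L.ric) = L.inner₂ L.ric L.ric := by
    rw [inner₂_G, tr_rmAct]
  simp only [rmAct_sub, rmAct_smul, rmAct_G, map_smul, map_sub, LinearMap.smul_apply,
    LinearMap.sub_apply, smul_eq_mul, inner₂_ric_G, L.inner₂_comm L.G L.ric, h]
  ring

lemma tr_ric_sub (s : A) :
    L.tr (L.ric - s • L.G) = L.scal - s * (Fintype.card ι : A) := by
  rw [← inner₂_G, map_sub, map_smul, inner₂_G_G, inner₂_comm, inner₂_ric_G, smul_eq_mul]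

section DimThree

variable [Invertible (2 : A)] (L : LeviCivita A (Fin 3))

/-- In dimension three the curvature is determined by the Ricci tensor. -/
lemma riem_fin_three (i j k l : Fin 3) :
    L.riem i j k l = L.G i k * L.ric j l + L.G j l * L.ric i k - L.G i l * L.ric j k
      - L.G j k * L.ric i l - ⅟2 * L.scal * (L.G i k * L.G j l - L.G i l * L.G j k) := by
  rw [← sub_eq_zero]
  have hdet : IsUnit (Matrix.of L.H).det := by
    have h := congrArg Matrix.det L.gMat_mul_hMat
    rw [Matrix.det_mul, Matrix.det_one] at h
    exact IsUnit.of_mul_eq_one_right _ h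
  -- The difference of the two sides has the curvature symmetries and no Ricci contraction.
  refine curvature_fin_three_eq_zero L.H L.H_symm hdet (fun i j k l => L.riem i j k l
    - (L.G i k * L.ric j l + L.G j l * L.ric i k - L.G i l * L.ric j k
      - L.G j k * L.ric i l - ⅟2 * L.scal * (L.G i k * L.G j l - L.G i l * L.G j k)))
    ?_ ?_ ?_ ?_ i j k l
  · intro i j k l
    linear_combination L.riem_skew i j k l
  · intro i j k l
    linear_combination L.riem_skew' i j k l
  · intro i j k l
    rw [L.G_symm k i, L.G_symm l j, L.G_symm k j, L.G_symm l i, L.ric_symm l j, L.ric_symm k i,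
      L.ric_symm l i, L.ric_symm k j]
    linear_combination L.riem_pair i j k l
  · intro j l
    change L.tr (fun i k => L.riem i j k l
      - (L.G i k * L.ric j l + L.G j l * L.ric i k - L.G i l * L.ric j k
      - L.G j k * L.ric i l - ⅟2 * L.scal * (L.G i k * L.G j l - L.G i l * L.G j k))) = 0
    have hG : L.tr L.G = 3 := by rw [tr_G]; simp
    have h1 : ∀ X : Fin 3 → A, L.tr (fun i k => L.G i l * X k) = X l := by
      intro X
      simp_rw [L.G_symm _ l]
      exact L.tr_G_mul l X
    have h2 : L.tr (fun i k => L.G j k * L.ric i l) = L.ric j l := by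
      rw [← tr_swap]
      exact L.tr_G_mul j fun i => L.ric i l
    simp only [tr_sub, tr_add, tr_mul_left, tr_mul_right, tr_riem₁]
    rw [hG, h1, h1, h2, ← scal, L.G_symm j l]
    have hhalf : (2 : A) * ⅟2 = 1 := mul_invOf_self 2
    linear_combination (L.scal * L.G l j) * hhalf

lemma rmPair_fin_three :
    L.inner₂ L.ric (L.rmAct L.ric) = 2 * L.scal * L.inner₂ L.ric L.ric
      - 2 * L.inner₂ L.ric (L.sq L.ric)
      - ⅟2 * L.scal * (L.scal ^ 2 - L.inner₂ L.ric L.ric) := by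
  have h : L.rmAct L.ric = L.inner₂ L.ric L.ric • L.G + L.scal • L.ric - (2 : A) • L.sq L.ric
      - (⅟2 * L.scal) • (L.scal • L.G - L.ric) := by
    ext i j
    have h1 : ∀ (i : Fin 3) (v : Fin 3 → A), L.inner₂ L.ric (fun k l => L.G i l * v k)
        = L.tr fun a b => L.ric i a * v b := by
      intro i v
      rw [inner₂_eq]
      congr 1
      ext a b
      rw [← tr_swap, L.ric_symm i a, ← L.tr_G_mul i fun l => L.ric a l * v b]
      congr 1
      ext k l
      ring
    have h2 : ∀ v : Fin 3 → A, L.inner₂ L.ric (fun k l => L.G k j * v l)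
        = L.tr fun a b => L.ric j a * v b := by
      intro v
      have hs : L.ric = fun a b => L.ric b a := by ext a b; exact L.ric_symm a b
      conv_lhs => rw [hs, ← inner₂_swap]
      simp_rw [L.G_symm _ j]
      exact h1 j v
    have hr : (fun k l => L.riem i k j l) = L.G i j • L.ric + L.ric i j • L.G
        - (fun k l => L.G i l * L.ric k j) - (fun k l => L.G k j * L.ric i l)
        - (⅟2 * L.scal) • (L.G i j • L.G - fun k l => L.G i l * L.G k j) := by
      ext k l
      rw [L.riem_fin_three]
      simp only [Pi.sub_apply, Pi.add_apply, Pi.smul_apply, smul_eq_mul]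
      ring
    rw [rmAct, hr]
    simp only [map_sub, map_add, map_smul, smul_eq_mul, inner₂_ric_G, h1, h2, Pi.sub_apply,
      Pi.add_apply, Pi.smul_apply, sq]
    have h3 : L.tr (fun a b => L.ric j a * L.ric i b) = L.tr fun a b => L.ric i a * L.ric b j := by
      rw [← tr_swap]
      congr 1
      ext a b
      rw [L.ric_symm j b, mul_comm]
    have h4 : L.tr (fun a b => L.ric i a * L.G b j) = L.ric i j := by
      simp_rw [mul_comm (L.ric i _), L.G_symm _ j]
      rw [← tr_swap, ← L.tr_G_mul j (L.ric i), ← tr_swap]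
    rw [h3, h4]
    ring
  rw [h]
  simp only [map_sub, map_add, map_smul, smul_eq_mul, inner₂_ric_G]
  ring

end DimThree

end LeviCivita
end TensorCalculus

/-! ### The connection of a metric, and contractions as explicit sums. -/

namespace TensorCalculus

namespace LeviCivita

section OfMetric

variable {A ι : Type*} [CommRing A] [Fintype ι] [DecidableEq ι] [Invertible (2 : A)]

/-- The Levi-Civita connection of a metric. -/
def ofMetric (d : ι → Derivation ℤ A A) (d_comm : ∀ i j a, d i (d j a) = d j (d i a))
    (G H : ι → ι → A) (G_symm : ∀ i j, G i j = G j i) (H_symm : ∀ i j, H i j = H j i)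
    (sum_G_H : ∀ i j, ∑ k, G i k * H k j = if i = j then 1 else 0) : LeviCivita A ι where
  d := d
  d_comm := d_comm
  G := G
  H := H
  Γ k i j := ⅟2 * ∑ l, H k l * (d i (G j l) + d j (G i l) - d l (G i j))
  G_symm := G_symm
  H_symm := H_symm
  sum_G_H := sum_G_H
  Γ_symm k i j := by
    congr 1
    refine Finset.sum_congr rfl fun l _ => ?_
    rw [G_symm i j]; ring
  compat k i j := by
    -- Lowering the upper index leaves Christoffel symbols of the first kind, and compatibility is
    -- then the sum of two of them.
    have h : ∀ r (X : ι → A), ∑ m, (⅟2 * ∑ l, H m l * X l) * G m r = ⅟2 * X r := by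
      intro r X
      calc ∑ m, (⅟2 * ∑ l, H m l * X l) * G m r
          = ∑ m, ∑ l, ⅟2 * (G r m * H m l * X l) := by
            refine Finset.sum_congr rfl fun m _ => ?_
            rw [Finset.mul_sum, Finset.sum_mul, G_symm m r]
            exact Finset.sum_congr rfl fun l _ => by ring
        _ = ⅟2 * ∑ l, (∑ m, G r m * H m l) * X l := by
            rw [Finset.sum_comm, Finset.mul_sum]
            exact Finset.sum_congr rfl fun l _ => by rw [Finset.sum_mul, Finset.mul_sum]
        _ = ⅟2 * X r := by simp [sum_G_H]
    simp_rw [Finset.sum_add_distrib, G_symm i]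
    rw [h j fun l => d k (G l i) + d i (G k l) - d l (G k i),
      h i fun l => d k (G j l) + d j (G k l) - d l (G k j), G_symm j i]
    have hhalf : (2 : A) * ⅟2 = 1 := mul_invOf_self 2
    linear_combination -(d k (G i j)) * hhalf

end OfMetric

section Expand

variable {A ι : Type*} [CommRing A] [Fintype ι] [DecidableEq ι] (L : LeviCivita A ι)

lemma inner₂_expand (S T : ι → ι → A) :
    L.inner₂ S T = ∑ i, ∑ j, ∑ k, ∑ l, L.H i k * L.H j l * S i j * T k l := by
  simp only [inner₂_eq, tr, smul_eq_mul, Finset.mul_sum]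
  refine Finset.sum_congr rfl fun i _ => ?_
  rw [Finset.sum_comm]
  refine Finset.sum_congr rfl fun j _ => Finset.sum_congr rfl fun k _ =>
    Finset.sum_congr rfl fun l _ => ?_
  ring

lemma nablaSq_expand (E : ι → ι → A) :
    L.nablaSq E = ∑ a, ∑ b, ∑ i, ∑ j, ∑ k, ∑ l, L.H a b * L.H i k * L.H j l *
      L.D a E i j * L.D b E k l := by
  simp only [nablaSq, pairing_apply, inner₂_expand, tr, smul_eq_mul, Finset.mul_sum, nabla_apply,
    ← mul_assoc]

lemma inner₂_raise (S T : ι → ι → A) :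
    L.inner₂ S T = ∑ i, ∑ k, (∑ a, ∑ b, L.H i a * L.H k b * S a b) * T i k := by
  rw [inner₂_comm, inner₂_expand]
  simp only [Finset.sum_mul]
  refine Finset.sum_congr rfl fun i _ => Finset.sum_congr rfl fun j _ =>
    Finset.sum_congr rfl fun k _ => Finset.sum_congr rfl fun l _ => ?_
  ring

lemma rmPair_expand (S : ι → ι → A) :
    L.inner₂ S (L.rmAct S) = ∑ i, ∑ j, ∑ k, ∑ l, L.riem i j k l *
      (∑ a, ∑ b, L.H i a * L.H k b * S a b) * (∑ a, ∑ b, L.H j a * L.H l b * S a b) := by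
  rw [inner₂_raise]
  refine Finset.sum_congr rfl fun i _ => ?_
  rw [Finset.sum_comm]
  refine Finset.sum_congr rfl fun k _ => ?_
  rw [rmAct, inner₂_raise, Finset.mul_sum]
  refine Finset.sum_congr rfl fun j _ => ?_
  rw [Finset.mul_sum]
  refine Finset.sum_congr rfl fun l _ => ?_
  ring

/-- In matrices, S² is S H S and ⟨S, T⟩ is tr(H S H Tᵀ); symmetry of `S` removes the transpose. -/
lemma inner₂_sq (S : ι → ι → A) (hS : ∀ i j, S i j = S j i) :
    L.inner₂ S (L.sq S) = Matrix.trace ((L.hMat * Matrix.of S) ^ 3) := by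
  have hsq : Matrix.of (L.sq S) = Matrix.of S * L.hMat * Matrix.of S := by
    ext i j
    simp only [sq, tr, smul_eq_mul, Matrix.of_apply, Matrix.mul_apply, hMat, Finset.sum_mul]
    rw [Finset.sum_comm]
    refine Finset.sum_congr rfl fun a _ => Finset.sum_congr rfl fun b _ => ?_
    ring
  have hin : ∀ T : ι → ι → A, L.inner₂ S T
      = Matrix.trace (L.hMat * Matrix.of S * (L.hMat * (Matrix.of T).transpose)) := by
    intro T
    simp only [inner₂_expand, Matrix.trace, Matrix.diag_apply, Matrix.mul_apply, hMat,
      Matrix.of_apply, Matrix.transpose_apply, Finset.sum_mul, Finset.mul_sum]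
    calc _ = ∑ j, ∑ i, ∑ k, ∑ l, L.H i k * L.H j l * S i j * T k l := Finset.sum_comm
      _ = ∑ j, ∑ k, ∑ i, ∑ l, L.H i k * L.H j l * S i j * T k l :=
        Finset.sum_congr rfl fun j _ => Finset.sum_comm
      _ = ∑ k, ∑ j, ∑ i, ∑ l, L.H i k * L.H j l * S i j * T k l := Finset.sum_comm
      _ = _ := by
        refine Finset.sum_congr rfl fun k _ => Finset.sum_congr rfl fun j _ => ?_
        rw [Finset.sum_comm]
        refine Finset.sum_congr rfl fun l _ => Finset.sum_congr rfl fun i _ => ?_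
        rw [L.H_symm i k]
        ring
  have hT : (Matrix.of (L.sq S)).transpose = Matrix.of (L.sq S) := by
    ext i j
    change L.sq S j i = L.sq S i j
    rw [sq, ← tr_swap, sq]
    congr 1
    ext a b
    rw [hS j b, hS a i, mul_comm]
  rw [hin, hT, hsq]
  congr 1
  noncomm_ring

end Expand
end LeviCivita

/-! ### Smooth functions on an open set -/

open TopologicalSpace

variable {n : ℕ} (U : Opens (Coord n))

/-- Extension by zero. -/
noncomputable def extend (u : U → ℝ) : Coord n → ℝ := Function.extend Subtype.val u 0

lemma extend_apply (u : U → ℝ) (y : U) : extend U u y = u y :=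
  Subtype.val_injective.extend_apply u 0 y

/-- The algebra of smooth functions on an open set. -/
noncomputable def smoothFun : Subalgebra ℝ (U → ℝ) where
  carrier := {u | ContDiffOn ℝ ∞ (extend U u) U}
  mul_mem' {u v} hu hv := (hu.mul hv).congr fun y hy => by
    lift y to U using hy
    simp [extend_apply]
  add_mem' {u v} hu hv := (hu.add hv).congr fun y hy => by
    lift y to U using hy
    simp [extend_apply]
  algebraMap_mem' r := (contDiffOn_const (c := r)).congr fun y hy => by
    lift y to U using hy
    simp [extend_apply]

variable {U}

/-- The element `a` of `smoothFun U` is the restriction of `u`. -/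
def Rep (a : smoothFun U) (u : Coord n → ℝ) : Prop := ∀ y : U, (a : U → ℝ) y = u y

/-- The restriction of a smooth function. -/
noncomputable def restrict (u : Coord n → ℝ) (hu : ContDiffOn ℝ ∞ u U) : smoothFun U :=
  ⟨fun y => u y, hu.congr fun y hy => extend_apply U _ ⟨y, hy⟩⟩

lemma rep_restrict (u : Coord n → ℝ) (hu : ContDiffOn ℝ ∞ u U) : Rep (restrict u hu) u :=
  fun _ => rfl

lemma rep_extend (a : smoothFun U) : Rep a (extend U a) := fun y => (extend_apply U _ y).symm

lemma Rep.contDiffOn {a : smoothFun U} {u : Coord n → ℝ} (h : Rep a u) : ContDiffOn ℝ ∞ u U :=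
  a.2.congr fun y hy => (h ⟨y, hy⟩).symm.trans (extend_apply U _ ⟨y, hy⟩).symm

lemma Rep.differentiableAt {a : smoothFun U} {u : Coord n → ℝ} (h : Rep a u) (y : U) :
    DifferentiableAt ℝ u y :=
  (h.contDiffOn.differentiableOn (by simp)).differentiableAt (U.2.mem_nhds y.2)

/-- As `U` is open, representatives share their germs at points of `U`, hence their partial
derivatives there. The extension by zero is therefore a harmless choice. -/
lemma Rep.eventuallyEq {a : smoothFun U} {u v : Coord n → ℝ} (hu : Rep a u) (hv : Rep a v)
    (y : U) : u =ᶠ[nhds (y : Coord n)] v := by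
  filter_upwards [U.2.mem_nhds y.2] with z hz
  exact (hu ⟨z, hz⟩).symm.trans (hv ⟨z, hz⟩)

lemma Rep.ext {a b : smoothFun U} {u : Coord n → ℝ} (ha : Rep a u) (hb : Rep b u) : a = b :=
  Subtype.ext <| funext fun y => (ha y).trans (hb y).symm

lemma contDiffOn_pd {u : Coord n → ℝ} (hu : ContDiffOn ℝ ∞ u U) (i : Fin n) :
    ContDiffOn ℝ ∞ (pd i u) U :=
  (hu.fderiv_of_isOpen U.2 (by simp)).clm_apply contDiffOn_const

lemma pd_pd_comm {u : Coord n → ℝ} (hu : ContDiffOn ℝ ∞ u U) (i j : Fin n) (y : U) :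
    pd i (pd j u) y = pd j (pd i u) y := by
  have hu2 : ContDiffAt ℝ ∞ u y := hu.contDiffAt (U.2.mem_nhds y.2)
  have hd : DifferentiableAt ℝ (fderiv ℝ u) y :=
    (hu2.fderiv_right (m := 1) (WithTop.coe_le_coe.mpr le_top)).differentiableAt (by simp)
  have h : ∀ i j, pd i (pd j u) y
      = fderiv ℝ (fderiv ℝ u) y (EuclideanSpace.single i 1) (EuclideanSpace.single j 1) := by
    intro i j
    have : fderiv ℝ (pd j u) y = _ := fderiv_clm_apply hd
      (differentiableAt_const (EuclideanSpace.single j (1 : ℝ)))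
    rw [pd, this]
    simp
  rw [h, h]
  exact (hu2.isSymmSndFDerivAt (by simpa using WithTop.coe_le_coe.mpr (le_top (a := (2 : ℕ∞))))) _ _

/-- The partial derivative of a smooth function. -/
noncomputable def pdDerivation (i : Fin n) : Derivation ℤ (smoothFun U) (smoothFun U) :=
  Derivation.mk'
    (AddMonoidHom.toIntLinearMap
      { toFun := fun a => restrict (pd i (extend U a)) (contDiffOn_pd (rep_extend a).contDiffOn i)
        map_zero' := by
          refine Rep.ext (rep_restrict _ _) fun y => ?_
          have h : Rep (0 : smoothFun U) 0 := fun _ => rfl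
          rw [pd, ((rep_extend 0).eventuallyEq h y).fderiv_eq]
          simp
        map_add' := fun a b => by
          refine Rep.ext (rep_restrict _ _) fun y => ?_
          have h : Rep (a + b) (extend U a + extend U b) := fun y =>
            congrArg₂ _ (rep_extend a y) (rep_extend b y)
          rw [pd, ((rep_extend (a + b)).eventuallyEq h y).fderiv_eq,
            fderiv_add ((rep_extend a).differentiableAt y) ((rep_extend b).differentiableAt y)]
          rfl })
    fun a b => by
      refine Rep.ext (rep_restrict _ (contDiffOn_pd (rep_extend (a * b)).contDiffOn i)) fun y => ?_
      have h : Rep (a * b) (extend U a * extend U b) := fun y =>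
        congrArg₂ _ (rep_extend a y) (rep_extend b y)
      rw [pd, ((rep_extend (a * b)).eventuallyEq h y).fderiv_eq,
        fderiv_mul ((rep_extend a).differentiableAt y) ((rep_extend b).differentiableAt y)]
      simp [extend_apply, pd, restrict]

lemma Rep.pd {a : smoothFun U} {u : Coord n → ℝ} (h : Rep a u) (i : Fin n) :
    Rep (pdDerivation i a) (pd i u) := by
  intro y
  change CoordGeom.pd i (extend U a) y = CoordGeom.pd i u y
  rw [CoordGeom.pd, CoordGeom.pd, ((rep_extend a).eventuallyEq h y).fderiv_eq]

lemma pdDerivation_comm (i j : Fin n) (a : smoothFun U) :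
    pdDerivation i (pdDerivation j a) = pdDerivation j (pdDerivation i a) := by
  refine Rep.ext (((rep_extend a).pd j).pd i) fun y => ?_
  rw [pd_pd_comm (rep_extend a).contDiffOn]
  exact (((rep_extend a).pd i).pd j) y

/-- Evaluation at a point. -/
noncomputable def eval (y : U) : smoothFun U →+* ℝ := (Pi.evalRingHom (fun _ : U => ℝ) y).comp (smoothFun U).val

lemma eval_apply (y : U) (a : smoothFun U) : eval y a = (a : U → ℝ) y := rfl

lemma Rep.eval {a : smoothFun U} {u : Coord n → ℝ} (h : Rep a u) (y : U) : eval y a = u y := h y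

noncomputable instance : Invertible (2 : smoothFun U) where
  invOf := algebraMap ℝ _ (1 / 2)
  invOf_mul_self := by
    exact Subtype.ext <| funext fun y => show (1 / 2 : ℝ) * 2 = 1 by norm_num
  mul_invOf_self := by
    exact Subtype.ext <| funext fun y => show (2 : ℝ) * (1 / 2) = 1 by norm_num

lemma eval_half (y : U) : eval y (⅟2 : smoothFun U) = 1 / 2 := rfl

lemma contDiffOn_det {m : ℕ} {M : Coord n → Matrix (Fin m) (Fin m) ℝ}
    (hM : ∀ i j, ContDiffOn ℝ ∞ (fun y => M y i j) U) : ContDiffOn ℝ ∞ (fun y => (M y).det) U := by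
  simp only [Matrix.det_apply']
  exact ContDiffOn.sum fun σ _ => contDiffOn_const.mul (contDiffOn_prod fun i _ => hM _ _)

lemma contDiffOn_inv {G : Tensor₂ n} (hG : ∀ i j, ContDiffOn ℝ ∞ (fun y => G y i j) U)
    (hdet : ∀ y ∈ U, IsUnit (G y).det) (i j : Fin n) :
    ContDiffOn ℝ ∞ (fun y => (G y)⁻¹ i j) U := by
  -- Cramer's rule reduces smoothness of the inverse to that of determinants.
  have h : ∀ y, (G y)⁻¹ i j = ((G y).det)⁻¹ * ((G y).updateRow j (Pi.single i 1)).det := by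
    intro y
    rw [Matrix.inv_def, Ring.inverse_eq_inv', Matrix.smul_apply, Matrix.adjugate_apply, smul_eq_mul]
  simp_rw [h]
  refine ((contDiffOn_det hG).inv fun y hy => (hdet y hy).ne_zero).mul (contDiffOn_det fun k l => ?_)
  simp only [Matrix.updateRow_apply]
  split_ifs
  · exact contDiffOn_const
  · exact hG k l

end TensorCalculus

/-! ### From the algebraic identities to coordinate formulas on an open set. -/

namespace TensorCalculus
open TopologicalSpace

variable {n : ℕ} {U : Opens (Coord n)}

/-- `G` is a smooth nondegenerate symmetric 2-tensor field on `U`. -/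
structure IsMetricOn (G : Tensor₂ n) (U : Opens (Coord n)) : Prop where
  smooth : ∀ i j, ContDiffOn ℝ ∞ (fun y => G y i j) U
  symm : ∀ y ∈ U, ∀ i j, G y i j = G y j i
  isUnit_det : ∀ y ∈ U, IsUnit (G y).det

lemma ext_eval {a b : smoothFun U} (h : ∀ y, eval y a = eval y b) : a = b :=
  Subtype.ext (funext h)

/-- `T` is the restriction of the tensor field `S`. -/
def RepT (T : Fin n → Fin n → smoothFun U) (S : Tensor₂ n) : Prop :=
  ∀ i j, Rep (T i j) fun y => S y i j

namespace IsMetricOn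

variable {G : Tensor₂ n}

lemma inv_symm (hG : IsMetricOn G U) (y : Coord n) (hy : y ∈ U) (i j : Fin n) : (G y)⁻¹ i j = (G y)⁻¹ j i := by
  have h : (G y).transpose = G y := by ext i j; exact hG.symm y hy j i
  have := Matrix.transpose_nonsing_inv (G y)
  rw [h] at this
  exact congrFun (congrFun this j) i

variable (hG : IsMetricOn G U)

/-- The Levi-Civita connection of a metric on an open set. -/
noncomputable def levi : LeviCivita (smoothFun U) (Fin n) :=
  LeviCivita.ofMetric pdDerivation pdDerivation_comm
    (fun i j => restrict (fun y => G y i j) (hG.smooth i j))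
    (fun i j => restrict (fun y => (G y)⁻¹ i j) (contDiffOn_inv hG.smooth hG.isUnit_det i j))
    (fun i j => Subtype.ext <| funext fun y => hG.symm y y.2 i j)
    (fun i j => Subtype.ext <| funext fun y => hG.inv_symm y y.2 i j)
    (fun i j => by
      have h : ∀ y : U, ∑ k, G y i k * (G y)⁻¹ k j = if i = j then 1 else 0 := fun y => by
        rw [← Matrix.one_apply, ← Matrix.mul_nonsing_inv _ (hG.isUnit_det y y.2), Matrix.mul_apply]
      refine ext_eval fun y => ?_
      rw [map_sum]
      refine (h y).trans ?_
      split_ifs <;> simp)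

lemma rep_G (i j : Fin n) : Rep (hG.levi.G i j) fun y => G y i j := fun _ => rfl

lemma rep_H (i j : Fin n) : Rep (hG.levi.H i j) fun y => (G y)⁻¹ i j := fun _ => rfl

lemma eval_d {a : smoothFun U} {u : Coord n → ℝ} (h : Rep a u) (i : Fin n) (y : U) :
    eval y (hG.levi.d i a) = pd i u y := h.pd i y

lemma rep_d {a : smoothFun U} {u : Coord n → ℝ} (h : Rep a u) (i : Fin n) :
    Rep (hG.levi.d i a) (pd i u) := h.pd i

lemma rep_christoffel (k i j : Fin n) : Rep (hG.levi.Γ k i j) (christoffel G k i j) := by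
  intro y
  change eval y (⅟2 * ∑ l, hG.levi.H k l * (hG.levi.d i (hG.levi.G j l)
    + hG.levi.d j (hG.levi.G i l) - hG.levi.d l (hG.levi.G i j))) = _
  simp only [map_mul, map_sum, map_add, map_sub, eval_half, (hG.rep_H _ _).eval,
    hG.eval_d (hG.rep_G _ _)]
  rfl

lemma rep_curv (l k i j : Fin n) : Rep (hG.levi.curv l k i j) (curvatureOp G l k i j) := by
  intro y
  rw [← eval_apply]
  simp only [LeviCivita.curv, map_mul, map_sum, map_add, map_sub, (hG.rep_christoffel _ _ _).eval,
    hG.eval_d (hG.rep_christoffel _ _ _)]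
  rfl

lemma rep_riem (i j k l : Fin n) : Rep (hG.levi.riem i j k l) (riemann G i j k l) := by
  intro y
  rw [← eval_apply]
  simp only [LeviCivita.riem, map_mul, map_sum, (hG.rep_G _ _).eval, (hG.rep_curv _ _ _ _).eval]
  rfl

lemma rep_trace {T : Fin n → Fin n → smoothFun U} {S : Tensor₂ n} (h : RepT T S) :
    Rep (hG.levi.tr T) (trace₂ G S) := by
  intro y
  rw [← eval_apply]
  simp only [LeviCivita.tr, smul_eq_mul, map_mul, map_sum, (hG.rep_H _ _).eval, (h _ _).eval]
  rfl

lemma rep_ricci : RepT hG.levi.ric (ricci G) := by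
  intro i j y
  rw [← eval_apply]
  simp only [LeviCivita.ric, LeviCivita.tr, smul_eq_mul, map_mul, map_sum, (hG.rep_H _ _).eval,
    (hG.rep_riem _ _ _ _).eval]
  rfl

lemma rep_scalar : Rep hG.levi.scal (scalar G) := hG.rep_trace hG.rep_ricci

lemma rep_covDeriv {T : Fin n → Fin n → smoothFun U} {S : Tensor₂ n} (h : RepT T S)
    (k i j : Fin n) : Rep (hG.levi.D k T i j) (covDeriv G S k i j) := by
  intro y
  rw [← eval_apply]
  simp only [LeviCivita.D_apply, LeviCivita.D_scalar, Pi.sub_apply, Finset.sum_apply,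
    Pi.smul_apply, smul_eq_mul, map_mul, map_sum, map_sub, (hG.rep_christoffel _ _ _).eval,
    hG.eval_d (h _ _), (h _ _).eval, covDeriv, Finset.sum_add_distrib]
  ring

lemma rep_hessian {a : smoothFun U} {u : Coord n → ℝ} (h : Rep a u) :
    RepT (hG.levi.nabla (hG.levi.nabla a)) (hessian G u) := by
  intro i j y
  rw [← eval_apply]
  simp only [LeviCivita.nabla_apply, LeviCivita.D_apply, LeviCivita.D_scalar, smul_eq_mul, map_mul,
    map_sum, map_sub, (hG.rep_christoffel _ _ _).eval, hG.eval_d h]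
  rw [hG.eval_d (hG.rep_d h j)]
  rfl

lemma rep_laplacian {a : smoothFun U} {u : Coord n → ℝ} (h : Rep a u) :
    Rep (hG.levi.lap a) (laplacian G u) := hG.rep_trace (hG.rep_hessian h)

lemma rep_gradInner {a b : smoothFun U} {u v : Coord n → ℝ} (ha : Rep a u) (hb : Rep b v) :
    Rep (hG.levi.inner₁ (hG.levi.nabla a) (hG.levi.nabla b)) (gradInner G u v) := by
  intro y
  rw [← eval_apply]
  simp only [LeviCivita.inner₁_eq, LeviCivita.tr, LeviCivita.nabla_apply, LeviCivita.D_scalar,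
    smul_eq_mul, map_mul, map_sum, (hG.rep_H _ _).eval, hG.eval_d ha, hG.eval_d hb, gradInner,
    mul_assoc]

lemma rep_normSq {T : Fin n → Fin n → smoothFun U} {S : Tensor₂ n} (h : RepT T S) :
    Rep (hG.levi.inner₂ T T) (normSq G S) := by
  intro y
  rw [← eval_apply]
  simp only [LeviCivita.inner₂_expand, map_mul, map_sum, (hG.rep_H _ _).eval, (h _ _).eval, normSq]

lemma rep_covDerivNormSq {T : Fin n → Fin n → smoothFun U} {S : Tensor₂ n} (h : RepT T S) :
    Rep (hG.levi.nablaSq T) (covDerivNormSq G S) := by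
  intro y
  rw [← eval_apply]
  simp only [LeviCivita.nablaSq_expand, map_mul, map_sum, (hG.rep_H _ _).eval,
    (hG.rep_covDeriv h _ _ _).eval, covDerivNormSq]

lemma rep_riemannPair {T : Fin n → Fin n → smoothFun U} {S : Tensor₂ n} (h : RepT T S) :
    Rep (hG.levi.inner₂ T (hG.levi.rmAct T)) (riemannPair G S) := by
  intro y
  rw [← eval_apply]
  simp only [LeviCivita.rmPair_expand, map_mul, map_sum, (hG.rep_H _ _).eval,
    (hG.rep_riem _ _ _ _).eval, (h _ _).eval, riemannPair, raise]

lemma rep_traceCube {T : Fin n → Fin n → smoothFun U} {S : Tensor₂ n} (h : RepT T S)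
    (hT : ∀ i j, T i j = T j i) :
    Rep (hG.levi.inner₂ T (hG.levi.sq T)) (traceCube G S) := by
  intro y
  rw [← eval_apply, LeviCivita.inner₂_sq _ _ hT]
  have h1 : (eval y).mapMatrix hG.levi.hMat = (G y)⁻¹ := by
    ext i j; exact (hG.rep_H i j).eval y
  have h2 : (eval y).mapMatrix (Matrix.of T) = S y := by
    ext i j; exact (h i j).eval y
  have h3 := AddMonoidHom.map_trace (eval y) ((hG.levi.hMat * Matrix.of T) ^ 3)
  rw [h3, traceCube, ← h1, ← h2, ← map_mul, ← map_pow]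
  rfl

end IsMetricOn

/-- The Bochner formula for the weighted Einstein tensor of a gradient Ricci soliton, in
coordinates. -/
theorem laplacian_normSq_weightedEinstein {G : Tensor₂ n} (hG : IsMetricOn G U)
    {F : Coord n → ℝ} (hF : ContDiffOn ℝ ∞ F U) (lam : ℝ)
    (hsol : ∀ y ∈ U, ricci G y + hessian G F y = lam • G y) (y : Coord n) (hy : y ∈ U) :
    laplacian G (normSq G (weightedEinstein G F)) y
      = 2 * covDerivNormSq G (weightedEinstein G F) y
        - gradInner G (normSq G (weightedEinstein G F)) F y
        - 2 * ((n : ℝ) - 2) * lam * normSq G (weightedEinstein G F) y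
        - 4 * riemannPair G (weightedEinstein G F) y
        - ((n : ℝ) - 2) * scalar G y * normSq G (weightedEinstein G F) y
        + scalar G y * trace₂ G (weightedEinstein G F) y ^ 2 := by
  set f := restrict F hF with hf
  have hrf : Rep f F := rep_restrict _ _
  have hexp : ContDiffOn ℝ ∞ (fun y => Real.exp (-F y)) U := hF.neg.exp
  set w := restrict _ hexp with hw
  have hrw : Rep w fun y => Real.exp (-F y) := rep_restrict _ _
  have hE : RepT (hG.levi.einstein w) (weightedEinstein G F) := by
    intro i j y
    rw [← eval_apply]
    simp only [LeviCivita.einstein, Pi.smul_apply, Pi.sub_apply, smul_eq_mul, map_mul, map_sub,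
      hrw.eval, eval_half, hG.rep_scalar.eval, (hG.rep_G _ _).eval, (hG.rep_ricci _ _).eval,
      weightedEinstein, Matrix.smul_apply, Matrix.sub_apply]
  -- The one property of e^{-f} that the algebraic formula requires.
  have hdw : ∀ a, hG.levi.d a w = -(w * hG.levi.d a f) := by
    intro a
    refine ext_eval fun y => ?_
    rw [hG.eval_d hrw, map_neg, map_mul, hG.eval_d hrf, hrw.eval, pd, pd,
      ((hrf.differentiableAt y).hasFDerivAt.fun_neg.exp).fderiv]
    simp
  have hsol' : ∀ i j, hG.levi.ric i j + hG.levi.D i (hG.levi.nabla f) j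
      = algebraMap ℝ _ lam * hG.levi.G i j := by
    intro i j
    refine ext_eval fun y => ?_
    have h := congrFun (congrFun (hsol y y.2) i) j
    have h1 := (hG.rep_ricci i j).eval y
    have h2 := (hG.rep_hessian hrf i j).eval y
    rw [map_add, h1, map_mul, (hG.rep_G i j).eval]
    rw [LeviCivita.nabla_apply] at h2
    rw [h2]
    exact h
  have hlam : ∀ a, hG.levi.d a (algebraMap ℝ _ lam) = 0 := by
    intro a
    refine ext_eval fun y => ?_
    have hc : Rep (algebraMap ℝ (smoothFun U) lam) fun _ => lam := fun _ => rfl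
    rw [hG.eval_d hc, pd]
    simp
  have h := congrArg (eval ⟨y, hy⟩) (LeviCivita.lap_normSq_einstein hlam hsol' hdw)
  simp only [map_add, map_sub, map_mul, map_pow, map_ofNat, map_natCast, Fintype.card_fin,
    (hG.rep_laplacian (hG.rep_normSq hE)).eval, (hG.rep_covDerivNormSq hE).eval,
    (hG.rep_gradInner (hG.rep_normSq hE) hrf).eval, (hG.rep_normSq hE).eval,
    (hG.rep_riemannPair hE).eval, hG.rep_scalar.eval, (hG.rep_trace hE).eval] at h
  exact h

end TensorCalculus

/-! ### The components of a manifold metric in a chart. -/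

namespace TensorCalculus
open TopologicalSpace

section Manifold

variable {n : ℕ} {M : Type*} [TopologicalSpace M] [ChartedSpace (Coord n) M]

lemma mfderiv_symm_injective {φ : OpenPartialHomeomorph M (Coord n)}
    (hφ : φ ∈ IsManifold.maximalAtlas (𝓡 n) ∞ M) {y : Coord n} (hy : y ∈ φ.target) :
    Function.Injective (mfderiv (𝓡 n) (𝓡 n) φ.symm y) := by
  have h : φ.MDifferentiable (𝓡 n) (𝓡 n) :=
    ⟨(contMDiffOn_of_mem_maximalAtlas hφ).mdifferentiableOn (by simp),
      (contMDiffOn_symm_of_mem_maximalAtlas hφ).mdifferentiableOn (by simp)⟩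
  exact h.symm.mfderiv_injective hy

variable [IsManifold (𝓡 n) ∞ M]

/-- A coordinate field is the tangent map of the inverse chart applied to a constant section. -/
lemma contMDiffOn_coordVector {φ : OpenPartialHomeomorph M (Coord n)}
    (hφ : φ ∈ IsManifold.maximalAtlas (𝓡 n) ∞ M) (i : Fin n) :
    ContMDiffOn (𝓡 n) (𝓡 n).tangent ∞
      (fun y => (⟨φ.symm y, coordVector φ i y⟩ : TangentBundle (𝓡 n) M)) φ.target := by
  have hs : ContMDiffOn (𝓡 n) (𝓡 n) ∞ φ.symm φ.target := contMDiffOn_symm_of_mem_maximalAtlas hφ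
  have hu : UniqueMDiffOn (𝓡 n) φ.target := φ.open_target.uniqueMDiffOn
  have ht := hs.contMDiffOn_tangentMapWithin (m := ∞) (by simp) hu
  have hc : ContMDiffOn (𝓡 n) (𝓡 n).tangent ∞ (fun y : Coord n =>
      (⟨y, EuclideanSpace.single i (1 : ℝ)⟩ : TangentBundle (𝓡 n) (Coord n))) φ.target :=
    contMDiffOn_vectorSpace_iff_contDiffOn.mpr contDiffOn_const
  refine (ht.comp hc fun y hy => hy).congr fun y hy => ?_
  have hd : MDifferentiableAt (𝓡 n) (𝓡 n) φ.symm y :=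
    (hs.contMDiffAt (φ.open_target.mem_nhds hy)).mdifferentiableAt (by simp)
  exact (tangentMapWithin_eq_tangentMap
    (p := (⟨y, EuclideanSpace.single i (1 : ℝ)⟩ : TangentBundle (𝓡 n) (Coord n)))
    (hu y hy) hd).symm

lemma coordMetric_contDiffOn (g : SmoothMetric n M) {φ : OpenPartialHomeomorph M (Coord n)}
    (hφ : φ ∈ IsManifold.maximalAtlas (𝓡 n) ∞ M) (i j : Fin n) :
    ContDiffOn ℝ ∞ (fun y => coordMetric g φ y i j) φ.target := by
  rw [← contMDiffOn_iff_contDiffOn]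
  intro y hy
  have hb : ContMDiffWithinAt (𝓡 n) (𝓡 n) ∞ φ.symm φ.target y :=
    contMDiffOn_symm_of_mem_maximalAtlas hφ y hy
  have : ContMDiffWithinAt (𝓡 n) ((𝓡 n).prod 𝓘(ℝ)) ∞
      (fun y ↦ Bundle.TotalSpace.mk' ℝ (E := Bundle.Trivial M ℝ) (φ.symm y)
        (g.inner (φ.symm y) (coordVector φ i y) (coordVector φ j y))) φ.target y := by
    apply ContMDiffWithinAt.clm_bundle_apply₂ (F₁ := Coord n) (F₂ := Coord n)
    · exact ContMDiffAt.comp_contMDiffWithinAt y g.contMDiff.contMDiffAt hb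
    · exact contMDiffOn_coordVector hφ i y hy
    · exact contMDiffOn_coordVector hφ j y hy
  simp only [Bundle.contMDiffWithinAt_totalSpace] at this
  exact this.2

/-- A kernel vector v gives X = Σ v_i ∂_i with g(X, X) = 0; positivity forces X = 0, and injectivity
of the differential forces v = 0. -/
lemma isUnit_det_coordMetric (g : SmoothMetric n M) {φ : OpenPartialHomeomorph M (Coord n)}
    (hφ : φ ∈ IsManifold.maximalAtlas (𝓡 n) ∞ M) {y : Coord n} (hy : y ∈ φ.target) :
    IsUnit (coordMetric g φ y).det := by
  rw [isUnit_iff_ne_zero]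
  intro h0
  obtain ⟨v, hv, h⟩ := Matrix.exists_mulVec_eq_zero_iff.mpr h0
  let x : Coord n := ∑ i, v i • EuclideanSpace.single i (1 : ℝ)
  have hx : ∀ i, x i = v i := by
    intro i
    simp [x, Pi.single_apply]
  let X : TangentSpace (𝓡 n) (φ.symm y) := mfderiv (𝓡 n) (𝓡 n) φ.symm y x
  have hX : X = ∑ i, v i • coordVector φ i y := by
    simp only [X, x, coordVector]
    erw [map_sum]
    refine Finset.sum_congr rfl fun i _ => ?_
    exact map_smul _ _ _
  have hXX : g.inner (φ.symm y) X X = 0 := by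
    have h1 : g.inner (φ.symm y) X X
        = ∑ i, v i * ∑ j, coordMetric g φ y i j * v j := by
      rw [hX]
      simp only [map_sum, map_smul, sum_apply, smul_apply, coordMetric, Matrix.of_apply, Finset.mul_sum, smul_eq_mul]
      refine Finset.sum_congr rfl fun i _ => Finset.sum_congr rfl fun j _ => ?_
      rw [g.symm]
      ring
    rw [h1]
    refine Finset.sum_eq_zero fun i _ => ?_
    have := congrFun h i
    simp only [Matrix.mulVec, dotProduct, Pi.zero_apply] at this
    rw [this, mul_zero]
  have hX0 : X = 0 := by
    by_contra hne
    exact (g.pos _ X hne).ne' hXX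
  have hx0 : x = 0 := mfderiv_symm_injective hφ hy (hX0.trans (map_zero _).symm)
  exact hv (funext fun i => by rw [← hx i, hx0]; rfl)

lemma isMetricOn_coordMetric (g : SmoothMetric n M) {φ : OpenPartialHomeomorph M (Coord n)}
    (hφ : φ ∈ IsManifold.maximalAtlas (𝓡 n) ∞ M) :
    IsMetricOn (coordMetric g φ) ⟨φ.target, φ.open_target⟩ where
  smooth := coordMetric_contDiffOn g hφ
  symm _ _ _ _ := g.symm _ _ _
  isUnit_det _ hy := isUnit_det_coordMetric g hφ hy

end Manifold

/-! ### Pointwise algebra of the tensors W(Ric − u g). -/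

section Pointwise

variable {n : ℕ} {U : Opens (Coord n)} {G : Tensor₂ n} (hG : IsMetricOn G U)

/-- The tensor field `W (Ric - u g)`. -/
noncomputable def ricciSub (G : Tensor₂ n) (W u : Coord n → ℝ) : Tensor₂ n :=
  fun y => W y • (ricci G y - u y • G y)

lemma rep_ricciSub {W u : Coord n → ℝ} {w s : smoothFun U} (hw : Rep w W) (hs : Rep s u) :
    RepT (w • (hG.levi.ric - s • hG.levi.G)) (ricciSub G W u) := by
  intro i j y
  rw [← eval_apply]
  simp only [Pi.smul_apply, Pi.sub_apply, smul_eq_mul, map_mul, map_sub, hs.eval, hw.eval,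
    (hG.rep_G _ _).eval, (hG.rep_ricci _ _).eval, Matrix.smul_apply, Matrix.sub_apply, ricciSub]

variable {W u : Coord n → ℝ} {y : Coord n}

lemma normSq_ricciSub (hG : IsMetricOn G U) (hW : ContDiffOn ℝ ∞ W U) (hu : ContDiffOn ℝ ∞ u U)
    (hy : y ∈ U) : normSq G (ricciSub G W u) y
      = W y ^ 2 * (normSq G (ricci G) y - 2 * u y * scalar G y + u y ^ 2 * n) := by
  have h := (hG.rep_normSq (rep_ricciSub hG (rep_restrict W hW) (rep_restrict u hu))).eval ⟨y, hy⟩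
  rw [← h]
  rw [map_smul, LinearMap.map_smul₂, LeviCivita.normSq_ric_sub]
  simp only [smul_eq_mul, map_add, map_sub, map_mul, map_pow, map_ofNat, map_natCast, Fintype.card_fin, (rep_restrict _ _).eval,
    hG.rep_scalar.eval, (hG.rep_normSq hG.rep_ricci).eval]
  ring

lemma trace_ricciSub (hG : IsMetricOn G U) (hW : ContDiffOn ℝ ∞ W U) (hu : ContDiffOn ℝ ∞ u U)
    (hy : y ∈ U) : trace₂ G (ricciSub G W u) y = W y * (scalar G y - u y * n) := by
  have h := (hG.rep_trace (rep_ricciSub hG (rep_restrict W hW) (rep_restrict u hu))).eval ⟨y, hy⟩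
  rw [← h, ← LeviCivita.inner₂_G, map_smul, LeviCivita.inner₂_G, LeviCivita.tr_ric_sub]
  simp only [smul_eq_mul, map_sub, map_mul, map_natCast, Fintype.card_fin, (rep_restrict _ _).eval,
    hG.rep_scalar.eval]

lemma riemannPair_ricciSub (hG : IsMetricOn G U) (hW : ContDiffOn ℝ ∞ W U)
    (hu : ContDiffOn ℝ ∞ u U) (hy : y ∈ U) : riemannPair G (ricciSub G W u) y
      = W y ^ 2 * (riemannPair G (ricci G) y - 2 * u y * normSq G (ricci G) y
        + u y ^ 2 * scalar G y) := by
  have h := (hG.rep_riemannPair (rep_ricciSub hG (rep_restrict W hW) (rep_restrict u hu))).eval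
    ⟨y, hy⟩
  rw [← h]
  rw [LeviCivita.rmAct_smul, map_smul, LinearMap.map_smul₂, LeviCivita.rmPair_ric_sub]
  simp only [smul_eq_mul, map_add, map_sub, map_mul, map_pow, map_ofNat,
    (rep_restrict _ _).eval, hG.rep_scalar.eval, (hG.rep_normSq hG.rep_ricci).eval,
    (hG.rep_riemannPair hG.rep_ricci).eval]
  ring

lemma riemannPair_ricci_three {U : Opens (Coord 3)} {G : Tensor₂ 3} (hG : IsMetricOn G U)
    {y : Coord 3} (hy : y ∈ U) :
    riemannPair G (ricci G) y = 2 * scalar G y * normSq G (ricci G) y - 2 * traceCube G (ricci G) y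
      - 1 / 2 * scalar G y * (scalar G y ^ 2 - normSq G (ricci G) y) := by
  have h := congrArg (eval ⟨y, hy⟩) hG.levi.rmPair_fin_three
  simpa only [map_sub, map_mul, map_pow, map_ofNat, eval_half, hG.rep_scalar.eval,
    (hG.rep_normSq hG.rep_ricci).eval, (hG.rep_riemannPair hG.rep_ricci).eval,
    (hG.rep_traceCube hG.rep_ricci hG.levi.ric_symm).eval] using h

end Pointwise

end TensorCalculus

/-! ### Assembly of the three identities. -/

theorem mainTheorem7 (n : ℕ) (hn : 3 ≤ n) {M : Type*} [TopologicalSpace M]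
    [ChartedSpace (Coord n) M] [IsManifold (𝓡 n) ∞ M]
    (g : SmoothMetric n M) (f : M → ℝ) (lam : ℝ) (hsol : IsGradientRicciSoliton g f lam)
    (φ : OpenPartialHomeomorph M (Coord n)) (hφ : φ ∈ IsManifold.maximalAtlas (𝓡 n) ∞ M)
    (p : M) (hp : p ∈ φ.source) :
    let G : Tensor₂ n := coordMetric g φ
    let F : Coord n → ℝ := f ∘ φ.symm
    let E : Tensor₂ n := weightedEinstein G F
    let T : Tensor₂ n := tracelessRicci G
    let R : Coord n → ℝ := scalar G
    let y : Coord n := φ p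
    ((1 / 2) * laplacian G (normSq G E) y
        = covDerivNormSq G E y - (1 / 2) * gradInner G (normSq G E) F y
          - ((n : ℝ) - 2) * lam * normSq G E y - 2 * riemannPair G E y
          - ((n : ℝ) - 2) / 2 * R y
            * (normSq G E y - 1 / ((n : ℝ) - 2) * trace₂ G E y ^ 2)) ∧
    ((1 / 2) * laplacian G (normSq G E) y
        = covDerivNormSq G E y - (1 / 2) * gradInner G (normSq G E) F y
          - ((n : ℝ) - 2) * lam * normSq G E y
          + Real.exp (-2 * F y) *
            (((n : ℝ) - 2) ^ 3 / (4 * (n : ℝ) ^ 2) * R y ^ 3 - 2 * riemannPair G T y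
              - ((n : ℝ) - 2) * ((n : ℝ) - 4) / (2 * (n : ℝ)) * R y * normSq G T y)) ∧
    (n = 3 →
      (1 / 2) * laplacian G (normSq G E) y
        = covDerivNormSq G E y - (1 / 2) * gradInner G (normSq G E) F y
          - lam * normSq G E y
          + Real.exp (-2 * F y) *
            (4 * traceCube G (ricci G) y - 7 / 2 * R y * normSq G (ricci G) y
              + 3 / 4 * R y ^ 3)) := by
  intro G F E T R y
  have hy : y ∈ (⟨φ.target, φ.open_target⟩ : TopologicalSpace.Opens (Coord n)) := φ.map_source hp
  have hG : TensorCalculus.IsMetricOn G ⟨φ.target, φ.open_target⟩ :=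
    TensorCalculus.isMetricOn_coordMetric g hφ
  have hF : ContDiffOn ℝ ∞ F φ.target := by
    rw [← contMDiffOn_iff_contDiffOn]
    exact hsol.smooth.comp_contMDiffOn (contMDiffOn_symm_of_mem_maximalAtlas hφ)
  have hW : ContDiffOn ℝ ∞ (fun y => Real.exp (-F y)) φ.target := hF.neg.exp
  have hR : ContDiffOn ℝ ∞ R φ.target := hG.rep_scalar.contDiffOn
  have main := TensorCalculus.laplacian_normSq_weightedEinstein hG hF lam
    (fun y hy => hsol.equation φ hφ y hy) y hy
  have hE : E = TensorCalculus.ricciSub G (fun y => Real.exp (-F y)) fun y => 1 / 2 * R y := rfl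
  have hT : T = TensorCalculus.ricciSub G (fun _ => 1) fun y => R y / n := by
    funext y
    exact (one_smul ℝ _).symm
  have hn0 : (n : ℝ) ≠ 0 := by positivity
  have hn2 : (n : ℝ) - 2 ≠ 0 := by
    have : (3 : ℝ) ≤ n := by exact_mod_cast hn
    linarith
  have hR2 : ContDiffOn ℝ ∞ (fun y => 1 / 2 * R y) φ.target := contDiffOn_const.mul hR
  have hRn : ContDiffOn ℝ ∞ (fun y => R y / n) φ.target := hR.div_const _
  have hEn := TensorCalculus.normSq_ricciSub hG hW hR2 hy
  have hEt := TensorCalculus.trace_ricciSub hG hW hR2 hy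
  have hEr := TensorCalculus.riemannPair_ricciSub hG hW hR2 hy
  have hTn := TensorCalculus.normSq_ricciSub (W := fun _ => 1) hG contDiffOn_const hRn hy
  have hTr := TensorCalculus.riemannPair_ricciSub (W := fun _ => 1) hG contDiffOn_const hRn hy
  have hexp : Real.exp (-2 * F y) = Real.exp (-F y) ^ 2 := by
    rw [← Real.exp_nat_mul]
    congr 1
    push_cast
    ring
  rw [show weightedEinstein G F = E from rfl, show scalar G = R from rfl] at main
  rw [← hE, show scalar G = R from rfl] at hEn hEt hEr
  rw [← hT, show scalar G = R from rfl] at hTn hTr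
  have first : (1 / 2) * laplacian G (normSq G E) y
      = covDerivNormSq G E y - (1 / 2) * gradInner G (normSq G E) F y
        - ((n : ℝ) - 2) * lam * normSq G E y - 2 * riemannPair G E y
        - ((n : ℝ) - 2) / 2 * R y
          * (normSq G E y - 1 / ((n : ℝ) - 2) * trace₂ G E y ^ 2) := by
    rw [main]
    field_simp
    ring
  have second : (1 / 2) * laplacian G (normSq G E) y
      = covDerivNormSq G E y - (1 / 2) * gradInner G (normSq G E) F y
        - ((n : ℝ) - 2) * lam * normSq G E y
        + Real.exp (-2 * F y) *
          (((n : ℝ) - 2) ^ 3 / (4 * (n : ℝ) ^ 2) * R y ^ 3 - 2 * riemannPair G T y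
            - ((n : ℝ) - 2) * ((n : ℝ) - 4) / (2 * (n : ℝ)) * R y * normSq G T y) := by
    -- Everything in the zeroth-order terms is now expressed through e^{-f}, R, |Ric|² and Rm(Ric,
    -- Ric), and the two forms agree as rational expressions.
    rw [first, hexp, hTn, hTr, hEr, hEt, hEn]
    field_simp
    ring
  refine ⟨first, second, ?_⟩
  intro h3
  subst h3
  have hX := TensorCalculus.riemannPair_ricci_three hG hy
  rw [show scalar G = R from rfl] at hX
  rw [second, hTn, hTr, hX]
  push_cast
  ring
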